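/- **Setting.** Fix $K\ge 1$ drafters, a maximal draft length $N=N_{\max}\ge 1$ and a finite vocabulary. Generation proceeds in rounds $t=1,2,\dots$. In round $t$ a drafter $a_t\in[K]$ is selected from what is known before the round. At the draft positions $j=1,\dots,N$ a token $x$ is drawn from the drafter's next-token distribution $q_{t,j}$ and passes the verification with probability $\min(1,p_{t,j}(x)/q_{t,j}(x))$, where $p_{t,j}$ is the target model's next-token distribution in the same context. The number $N_{acc}(t)$ of accepted tokens is the number of drafted tokens before the first one that fails, and the round generates $N_{acc}(t)+1$ tokens. Put $\alpha_{t,j}=1-d_{TV}(p_{t,j},q_{t,j})$; the block divergence reward of the round is $r_t=\frac1N\sum_{j=1}^N\alpha_{t,j}$. The policy may use at least the rates $\alpha_{s,j}$ and verification results of earlier rounds $s<t$. *Stationarity assumption.* The acceptance rates of drafter $i$ are i.i.d. from a distribution $\nu_i$ with mean $\alpha_i$: if $a_t=i$, then each $\alpha_{t,j}$ has law $\nu_i$, independently of the policy's information before round $t$ and of the rates and verification results at the earlier positions of round $t$. Suppose the optimal drafter $i^\star$ is unique, i.e. $\alpha_i<\alpha_{i^\star}$ for $i\ne i^\star$, and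 put $\Delta(\alpha_i)=\alpha_{i^\star}-\alpha_i$. *Regret.* For a target length $B\in\mathbb N$, $B\ge1$, let $\tau(\pi,B)$ be the total number of rounds of the policy $\pi$ until $B$ tokens are generated, and $\mathrm{Reg}(\pi,B)=\mathbb E[\tau(\pi,B)]-\inf_{\pi'}\mathbb E[\tau(\pi',B)]$, the infimum being over all selection policies. *MetaSD-UCB with exploration parameter $\beta$.* First every drafter is used for one round (these $K$ rounds are always executed). Then, while fewer than $B$ tokens have been generated, and $t$ rounds have been completed, the next drafter maximizes $$\hat\mu_{i,t}+\frac{\beta}{\sqrt{N_{\max}}}\sqrt{\frac{2\ln t}{n_i(t)}},$$ with arbitrary tie-breaking, where $n_i(t)$ is the number of rounds among the first $t$ in which drafter $i$ was used and $\hat\mu_{i,t}$ is the average block divergence reward of those rounds. **Theorem (regret upper bound containing $\beta$).** For $\beta>\frac12$ put $$D(\beta)=1+\frac{4}{\ln(2\beta^2+\frac12)}\left(\frac{2\beta^2+\frac12}{2\beta^2-\frac12}\right)^2 .$$ There are absolute constants $c,C'>0$ such that for all $K,N_{\max}$, all $\beta>\frac12$, all models as above and all $B\ge1$, MetaSD-UCB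 with exploration parameter $\beta$ satisfies $$\mathrm{Reg}(\pi,B)<\sum_{i\ne i^\star}\frac{8\beta^2}{N_{\max}\,\Delta(\alpha_i)^2}\left(\ln B+\max\Big\{0,\ln\ln\sum_{k\ne i^\star}\frac1{\Delta(\alpha_k)^2}\Big\}+C'\right)+C,\qquad C=c\,K\,D(\beta),$$ where $\max\{0,\ln\ln S\}$ is read as $0$ for $S\le 1$. The additive constant blows up as $\beta$ approaches $\frac12$: $D(\beta)\to\infty$ as $\beta\downarrow\frac12$. -/

import Mathlib

open MeasureTheory ProbabilityTheory Filter Topology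

universe u v

namespace MetaSD

/-- Total variation distance `½ ‖p - q‖₁` of two probability vectors on a finite vocabulary. -/
noncomputable def tvDist {V : Type*} [Fintype V] (p q : V → ℝ) : ℝ :=
  (1 / 2) * ∑ v, |p v - q v|

/-- The random quantities of a multi-drafter speculative decoding run with `K` drafters and
maximal draft length `N`, over the vocabulary `V`. Rounds are numbered `0, 1, 2, …`, the draft
positions of a round `0, …, N - 1`. The run is continued for ever; `rounds` below says when the
generation is stopped. -/
structure Run (K N : ℕ) (V : Type v) [Fintype V] [MeasurableSpace V] where
  /-- the sample space -/
  Ω : Type u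
  /-- its events -/
  [mΩ : MeasurableSpace Ω]
  /-- the probability -/
  μ : Measure Ω
  /-- `ℱ t` is what the drafter selection policy can use before round `t` (it may contain
  randomness of the policy's own) -/
  ℱ : Filtration ℕ mΩ
  /-- `arm t` is the drafter selected in round `t` -/
  arm : ℕ → Ω → Fin K
  /-- `p t j` is the next-token distribution of the target model at draft position `j` of
  round `t`, given the prompt, the tokens generated so far and the first `j` drafted tokens -/
  p : ℕ → Fin N → Ω → V → ℝ
  /-- `q t j` is the next-token distribution of the selected drafter in the same context -/
  q : ℕ → Fin N → Ω → V → ℝ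
  /-- `token t j` is the token drafted at position `j` of round `t` -/
  token : ℕ → Fin N → Ω → V
  /-- `u t j` is the uniform random number used to verify that token -/
  u : ℕ → Fin N → Ω → ℝ

attribute [instance] Run.mΩ

namespace Run

variable {K N : ℕ} {V : Type v} [Fintype V] [MeasurableSpace V] (R : Run.{u, v} K N V)

/-- The acceptance rate `1 - d_TV(p, q)` of the selected drafter at draft position `j` of
round `t`. -/
noncomputable def rate (t : ℕ) (j : Fin N) (ω : R.Ω) : ℝ :=
  1 - tvDist (R.p t j ω) (R.q t j ω)

/-- The event that the `j`-th drafted token `x` of round `t` passes the verification of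
speculative sampling, `u ≤ min (1, p(x) / q(x))`. -/
def passes (t : ℕ) (j : Fin N) : Set R.Ω :=
  {ω | R.u t j ω ≤ min 1 (R.p t j ω (R.token t j ω) / R.q t j ω (R.token t j ω))}

open Classical in
/-- The number of accepted tokens of round `t`: the drafted tokens before the first one that
does not pass. -/
noncomputable def nAcc (t : ℕ) (ω : R.Ω) : ℕ :=
  (Finset.univ.filter fun j : Fin N => ∀ k ≤ j, ω ∈ R.passes t k).card

/-- The block divergence reward of round `t`. -/
noncomputable def bdReward (t : ℕ) (ω : R.Ω) : ℝ :=
  (1 / (N : ℝ)) * ∑ j, R.rate t j ω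

/-- The number of tokens generated in the first `n` rounds; each round yields its accepted
tokens and one token of the target model. -/
noncomputable def generated (n : ℕ) (ω : R.Ω) : ℕ :=
  ∑ t ∈ Finset.range n, (R.nAcc t ω + 1)

/-- The total number of rounds `τ` when `m` initial rounds are executed unconditionally and
further rounds are executed as long as fewer than `B` tokens have been generated. -/
noncomputable def rounds (m B : ℕ) (ω : R.Ω) : ℕ :=
  sInf {n | m ≤ n ∧ B ≤ R.generated n ω}

/-- The expected total number of rounds. -/
noncomputable def expectedRounds (m B : ℕ) : ℝ :=
  ∫ ω, (R.rounds m B ω : ℝ) ∂(R.μ)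

/-- What is known of the rates and of the verifications just before draft position `j` of
round `t`: the knowledge `ℱ t` of the policy, and the acceptance rates and verification results
at the earlier positions of the round. -/
@[reducible]
noncomputable def before (t : ℕ) (j : Fin N) : MeasurableSpace R.Ω :=
  R.ℱ t ⊔ ⨆ k : Fin N, ⨆ _ : k < j,
    (MeasurableSpace.comap (R.rate t k) inferInstance ⊔
      MeasurableSpace.generateFrom {R.passes t k})

/-- `before t j` together with the next-token distributions at draft position `j`. -/
@[reducible]
noncomputable def beforeDraft (t : ℕ) (j : Fin N) : MeasurableSpace R.Ω :=
  R.before t j ⊔ MeasurableSpace.comap (R.p t j) inferInstance ⊔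
    MeasurableSpace.comap (R.q t j) inferInstance

/-- `R` is a run of speculative decoding with a non-anticipating drafter selection, in which the
acceptance rates of drafter `i` are i.i.d. with distribution `ν i`. -/
structure IsStationarySD (ν : Fin K → Measure ℝ) : Prop where
  isProbabilityMeasure : IsProbabilityMeasure R.μ
  measurable_p : ∀ t j, Measurable (R.p t j)
  measurable_q : ∀ t j, Measurable (R.q t j)
  measurable_token : ∀ t j, Measurable (R.token t j)
  measurable_u : ∀ t j, Measurable (R.u t j)
  /-- `p` and `q` are probability vectors. -/
  p_mem : ∀ t j ω, R.p t j ω ∈ stdSimplex ℝ V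
  q_mem : ∀ t j ω, R.q t j ω ∈ stdSimplex ℝ V
  /-- The drafter of round `t` is selected from what is known before round `t`. -/
  measurable_arm : ∀ t, Measurable[R.ℱ t] (R.arm t)
  /-- The acceptance rates and verification results of round `t` are known after round `t`. -/
  measurable_rate : ∀ t j, Measurable[R.ℱ (t + 1)] (R.rate t j)
  measurableSet_passes : ∀ t j, MeasurableSet[R.ℱ (t + 1)] (R.passes t j)
  /-- If drafter `i` is selected in round `t`, each acceptance rate of the round has the
  distribution `ν i`, whatever happened before. -/
  rate_law : ∀ t j i (E : Set R.Ω), MeasurableSet[R.before t j] E →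
    (∀ ω ∈ E, R.arm t ω = i) → ∀ S : Set ℝ, MeasurableSet S →
      R.μ (E ∩ R.rate t j ⁻¹' S) = R.μ E * ν i S
  /-- The drafted token has the conditional distribution `q t j`. -/
  token_law : ∀ t j v (E : Set R.Ω), MeasurableSet[R.beforeDraft t j] E →
    R.μ.real (E ∩ {ω | R.token t j ω = v}) = ∫ ω in E, R.q t j ω v ∂(R.μ)
  /-- The number `u t j` is uniform on `[0, 1]` and independent of all that precedes it. -/
  u_law : ∀ t j, R.μ.map (R.u t j) = volume.restrict (Set.Icc 0 1)
  u_indep : ∀ t j, Indep (MeasurableSpace.comap (R.u t j) inferInstance)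
    (R.beforeDraft t j ⊔ MeasurableSpace.comap (R.token t j) inferInstance) R.μ

/-- The number of times drafter `i` is selected in the first `t` rounds. -/
def pulls (i : Fin K) (t : ℕ) (ω : R.Ω) : ℕ :=
  ((Finset.range t).filter fun s => R.arm s ω = i).card

/-- The empirical mean of the block divergence rewards of drafter `i` in the first `t` rounds. -/
noncomputable def empMean (i : Fin K) (t : ℕ) (ω : R.Ω) : ℝ :=
  (∑ s ∈ (Finset.range t).filter (fun s => R.arm s ω = i), R.bdReward s ω) / R.pulls i t ω

/-- The upper confidence index with exploration coefficient `b`. -/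
noncomputable def ucbIndex (b : ℝ) (i : Fin K) (t : ℕ) (ω : R.Ω) : ℝ :=
  R.empMean i t ω + b * √(2 * Real.log t / R.pulls i t ω)

/-- The drafters are selected by MetaSD-UCB with exploration coefficient `b`: first every drafter
once, then in each round a drafter with the largest index (ties are broken in any way). -/
def IsMetaSDUCB (b : ℝ) : Prop :=
  (∀ (i : Fin K) (ω : R.Ω), R.arm i ω = i) ∧
    ∀ t, K ≤ t → ∀ (ω : R.Ω) (i : Fin K), R.ucbIndex b i t ω ≤ R.ucbIndex b (R.arm t ω) t ω

end Run

/-- The least expected number of rounds `E[τ(π⋆, B)]` over all drafter selection policies, when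
the acceptance rates of drafter `i` have the distribution `ν i`. -/
noncomputable def optimalRounds {K : ℕ} (N : ℕ) (V : Type v) [Fintype V]
    [MeasurableSpace V] (ν : Fin K → Measure ℝ) (B : ℕ) : ℝ :=
  sInf {x : ℝ | ∃ R : Run.{u, v} K N V, R.IsStationarySD ν ∧ x = R.expectedRounds 0 B}

/-- The stopping time regret of a run of MetaSD-UCB, whose first `K` rounds (one for each
drafter) are executed unconditionally. -/
noncomputable def ucbRegret {K N : ℕ} {V : Type v} [Fintype V] [MeasurableSpace V]
    (R : Run.{u, v} K N V) (ν : Fin K → Measure ℝ) (B : ℕ) : ℝ :=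
  R.expectedRounds K B - optimalRounds.{u, v} N V ν B

/-- The dependence of the additive constant on the exploration parameter `β`. -/
noncomputable def betaConst (β : ℝ) : ℝ :=
  1 + 4 / Real.log (2 * β ^ 2 + 1 / 2) *
    ((2 * β ^ 2 + 1 / 2) / (2 * β ^ 2 - 1 / 2)) ^ 2

end MetaSD

/-! A dynamic-programming comparison turns regret into a count of suboptimal rounds, and a UCB
analysis bounds that count.

Token `x` is drafted with probability `q x` and kept with probability `min 1 (p x / q x)`, so a
position passes with probability `∑ min p q`, one minus the total variation distance; given the past
its mean is `α i`. Since the rates are fresh at every position, the first `n` tokens of a round all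
pass with conditional probability `α i ^ n` (`integral_mul_passesFirst`). The law of the tokens
gained in a round thus depends on the drafter only through its mean.

Let `V b` be the expected number of rounds for `b` tokens with the best drafter, `remainingRounds N
(α istar) b`. It satisfies a Bellman equation and is monotone, so a round with any drafter lowers
the expectation of `V` at the missing tokens by at most the probability that the round is needed.
Telescoping gives `V B ≤ E τ` for every policy. A needed round with the best drafter lowers it by
exactly one on average, and no round raises it, so at most `V B` needed rounds use the best drafter
in expectation. Hence the regret is at most `K` plus the expected number of suboptimal selections in
rounds `K, …, B - 1` (`expectedRounds_le`); at least one token per round limits the horizon to `max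
K B`.

For these selections, averaging `N` conditionally fresh rates gives the exponential supermartingale
of `integral_exp_excess_le_one`, with variance proxy `1 / (4 N)` per round. At a fixed selection
count, the chance of leaving the confidence width at time `t` is at most `t ^ (-4 β ^ 2)`, summable
because `β > 1 / 2`. The count is random, so `measureReal_deviation_le` slices it geometrically,
which costs part of the surplus in the exponent. Outside the deviation events a suboptimal drafter
is selected only while its count is below `8 β ^ 2 ln B / (N Δ ^ 2)`. The deviation events add `28 /
δ ^ 3`, which `betaConst` dominates. -/

namespace MetaSD

/-! ### Conditional averaging, and verification versus total variation. -/

/-- Two integrable functions with the same integral over every set of a sub-σ-algebra have the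
same integral against every bounded function measurable in it. -/
theorem integral_mul_eq_of_forall_setIntegral_eq {Ω : Type*} {m mΩ : MeasurableSpace Ω}
    {μ : Measure Ω} [IsFiniteMeasure μ] (hm : m ≤ mΩ) {f g Z : Ω → ℝ} {C : ℝ}
    (hf : Integrable f μ) (hg : Integrable g μ)
    (hfg : ∀ E, MeasurableSet[m] E → ∫ ω in E, f ω ∂μ = ∫ ω in E, g ω ∂μ)
    (hZ : Measurable[m] Z) (hZC : ∀ ω, |Z ω| ≤ C) :
    ∫ ω, Z ω * f ω ∂μ = ∫ ω, Z ω * g ω ∂μ := by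
  have hZ' : StronglyMeasurable[m] Z := hZ.stronglyMeasurable
  -- Equal integrals over `m`-sets mean equal conditional expectations, and the `m`-measurable
  -- bounded factor `Z` can be pulled out of either one.
  have hae : μ[g|m] =ᵐ[μ] μ[f|m] := by
    refine ae_eq_condExp_of_forall_setIntegral_eq hm hf
      (fun s _ _ => integrable_condExp.integrableOn) (fun s hs _ => ?_)
      stronglyMeasurable_condExp.aestronglyMeasurable
    rw [setIntegral_condExp hm hg hs, hfg s hs]
  have key : ∀ k : Ω → ℝ, Integrable k μ →
      ∫ ω, Z ω * k ω ∂μ = ∫ ω, Z ω * (μ[k|m]) ω ∂μ := by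
    intro k hk
    have h1 := condExp_stronglyMeasurable_mul_of_bound hm hZ' hk C
      (Eventually.of_forall fun ω => by simpa using hZC ω)
    rw [← integral_condExp hm]
    exact integral_congr_ae h1
  rw [key f hf, key g hg]
  refine integral_congr_ae ?_
  filter_upwards [hae] with ω hω
  rw [hω]

/-- A uniform variable independent of a σ-algebra lies below a threshold measurable in that
σ-algebra with conditional probability equal to the threshold. -/
theorem measureReal_inter_uniform_le {Ω : Type*} {m mΩ : MeasurableSpace Ω} {μ : Measure Ω}
    [IsProbabilityMeasure μ] (hm : m ≤ mΩ) {U c : Ω → ℝ} (hU : Measurable U)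
    (hlaw : μ.map U = volume.restrict (Set.Icc 0 1))
    (hind : Indep (MeasurableSpace.comap U inferInstance) m μ)
    (hc : Measurable[m] c) (hc0 : ∀ ω, 0 ≤ c ω) (hc1 : ∀ ω, c ω ≤ 1)
    {E : Set Ω} (hE : MeasurableSet[m] E) :
    μ.real (E ∩ {ω | U ω ≤ c ω}) = ∫ ω in E, c ω ∂μ := by
  classical
  -- The value `-1` encodes the restriction to `E`: as `U ≥ 0` almost surely, `U ≤ d` fails off `E`.
  -- A single independent pair `(U, d)` then suffices for Fubini.
  set d : Ω → ℝ := fun ω => if ω ∈ E then c ω else -1 with hd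
  have hdm : Measurable[m] d := Measurable.ite hE hc measurable_const
  have hdΩ : Measurable d := hdm.mono hm le_rfl
  have hindep : IndepFun U d μ := by
    rw [IndepFun_iff_Indep]
    exact indep_of_indep_of_le_right hind hdm.comap_le
  have hprod := (indepFun_iff_map_prod_eq_prod_map_map hU.aemeasurable hdΩ.aemeasurable).1 hindep
  have hS : MeasurableSet {x : ℝ × ℝ | x.1 ≤ x.2} := measurableSet_le measurable_fst measurable_snd
  have hvol : ∀ y : ℝ, y ≤ 1 → (μ.map U) (Set.Iic y) = ENNReal.ofReal y := by
    intro y hy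
    rw [hlaw, Measure.restrict_apply measurableSet_Iic]
    have : Set.Iic y ∩ Set.Icc 0 1 = Set.Icc 0 y := by
      ext x; simp only [Set.mem_inter_iff, Set.mem_Iic, Set.mem_Icc]; grind
    rw [this, Real.volume_Icc, sub_zero]
  have hmeas : μ {ω | U ω ≤ d ω} = ∫⁻ ω, ENNReal.ofReal (d ω) ∂μ := by
    have h1 : μ {ω | U ω ≤ d ω} = (μ.map fun ω => (U ω, d ω)) {x : ℝ × ℝ | x.1 ≤ x.2} := by
      rw [Measure.map_apply (hU.prodMk hdΩ) hS]; rfl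
    have := Measure.isProbabilityMeasure_map (μ := μ) hU.aemeasurable
    have := Measure.isProbabilityMeasure_map (μ := μ) hdΩ.aemeasurable
    rw [h1, hprod, Measure.prod_apply_symm hS, lintegral_map (measurable_measure_prodMk_right hS) hdΩ]
    refine lintegral_congr fun ω => ?_
    refine hvol (d ω) ?_
    simp only [hd]; split_ifs
    · exact hc1 ω
    · norm_num
  have hneg : μ {ω | U ω ≤ -1} = 0 := by
    have := hvol (-1) (by norm_num)
    rw [Measure.map_apply hU measurableSet_Iic] at this
    rw [show {ω | U ω ≤ -1} = U ⁻¹' Set.Iic (-1) from rfl, this]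
    simp
  have hset : μ (E ∩ {ω | U ω ≤ c ω}) = μ {ω | U ω ≤ d ω} := by
    refine measure_congr ?_
    have h0 : ∀ᵐ ω ∂μ, ¬ U ω ≤ -1 := by rw [ae_iff]; simpa using hneg
    filter_upwards [h0] with ω hω
    refine propext ?_
    change (ω ∈ E ∧ U ω ≤ c ω) ↔ U ω ≤ d ω
    by_cases h : ω ∈ E <;> simp [hd, h, not_le.1 hω]
  have hEΩ := hm E hE
  have hcint : Integrable c μ := Integrable.of_bound (hc.mono hm le_rfl).aestronglyMeasurable 1
    (Eventually.of_forall fun ω => by rw [Real.norm_of_nonneg (hc0 ω)]; exact hc1 ω)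
  rw [Measure.real, hset, hmeas, integral_eq_lintegral_of_nonneg_ae
    (Eventually.of_forall fun ω => hc0 ω) hcint.1.restrict, ← lintegral_indicator hEΩ]
  congr 1
  refine lintegral_congr fun ω => ?_
  by_cases h : ω ∈ E <;> simp [hd, h]

theorem one_sub_tvDist {V : Type*} [Fintype V] {p q : V → ℝ} (hp : p ∈ stdSimplex ℝ V)
    (hq : q ∈ stdSimplex ℝ V) : 1 - tvDist p q = ∑ v, min (p v) (q v) := by
  have h : ∀ v, min (p v) (q v) = 1 / 2 * p v + 1 / 2 * q v - 1 / 2 * |p v - q v| := by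
    intro v
    rcases le_total (p v) (q v) with h | h
    · rw [min_eq_left h, abs_of_nonpos (by linarith)]; ring
    · rw [min_eq_right h, abs_of_nonneg (by linarith)]; ring
  simp only [h, Finset.sum_sub_distrib, Finset.sum_add_distrib, ← Finset.mul_sum, hp.2, hq.2,
    tvDist]
  ring

theorem one_sub_tvDist_mem_Icc {V : Type*} [Fintype V] {p q : V → ℝ} (hp : p ∈ stdSimplex ℝ V)
    (hq : q ∈ stdSimplex ℝ V) : 1 - tvDist p q ∈ Set.Icc (0 : ℝ) 1 := by
  constructor
  · rw [one_sub_tvDist hp hq]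
    exact Finset.sum_nonneg fun v _ => le_min (hp.1 v) (hq.1 v)
  · have : 0 ≤ tvDist p q := by unfold tvDist; positivity
    linarith

/-- At `q = 0` the convention `p / 0 = 0` is harmless: a token that is never drafted contributes
zero on both sides. -/
theorem mul_min_one_div {p q : ℝ} (hp : 0 ≤ p) (hq : 0 ≤ q) : q * min 1 (p / q) = min p q := by
  rcases hq.eq_or_lt with rfl | hq
  · simp [hp]
  · rw [mul_min_of_nonneg _ _ hq.le, mul_one, mul_div_cancel₀ _ hq.ne', min_comm]

/-! ### Measurability of the run and conditional acceptance probabilities. -/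

namespace Run.IsStationarySD

variable {K N : ℕ} {V : Type v} [Fintype V] [MeasurableSpace V] {R : Run.{u, v} K N V}
  {ν : Fin K → Measure ℝ} {α : Fin K → ℝ}

theorem rate_mem_Icc (H : R.IsStationarySD ν) (t : ℕ) (j : Fin N) (ω : R.Ω) :
    R.rate t j ω ∈ Set.Icc (0 : ℝ) 1 :=
  one_sub_tvDist_mem_Icc (H.p_mem t j ω) (H.q_mem t j ω)

theorem measurable_rate_top (H : R.IsStationarySD ν) (t : ℕ) (j : Fin N) :
    Measurable (R.rate t j) :=
  (H.measurable_rate t j).mono (R.ℱ.le _) le_rfl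

theorem measurableSet_passes_top (H : R.IsStationarySD ν) (t : ℕ) (j : Fin N) :
    MeasurableSet (R.passes t j) :=
  R.ℱ.le _ _ (H.measurableSet_passes t j)

theorem before_le (H : R.IsStationarySD ν) (t : ℕ) (j : Fin N) : R.before t j ≤ R.mΩ := by
  refine sup_le (R.ℱ.le t) (iSup₂_le fun k _ => sup_le ?_ ?_)
  · exact (H.measurable_rate_top t k).comap_le
  · refine MeasurableSpace.generateFrom_le ?_
    rintro _ rfl
    exact H.measurableSet_passes_top t k

theorem beforeDraft_le (H : R.IsStationarySD ν) (t : ℕ) (j : Fin N) :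
    R.beforeDraft t j ≤ R.mΩ :=
  sup_le (sup_le (H.before_le t j) (H.measurable_p t j).comap_le) (H.measurable_q t j).comap_le

end Run.IsStationarySD

namespace Run

variable {K N : ℕ} {V : Type v} [Fintype V] [MeasurableSpace V] (R : Run.{u, v} K N V)

theorem filtration_le_before (t : ℕ) (j : Fin N) : R.ℱ t ≤ R.before t j := le_sup_left

theorem before_le_beforeDraft (t : ℕ) (j : Fin N) : R.before t j ≤ R.beforeDraft t j :=
  le_sup_left.trans le_sup_left

theorem measurable_rate_before (t : ℕ) {j k : Fin N} (h : k < j) :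
    Measurable[R.before t j] (R.rate t k) := by
  have : MeasurableSpace.comap (R.rate t k) inferInstance ≤ R.before t j :=
    (le_sup_left.trans (le_iSup₂ (f := fun (k : Fin N) (_ : k < j) =>
      (MeasurableSpace.comap (R.rate t k) inferInstance ⊔
      MeasurableSpace.generateFrom {R.passes t k})) k h)).trans le_sup_right
  exact (comap_measurable _).mono this le_rfl

theorem measurableSet_passes_before (t : ℕ) {j k : Fin N} (h : k < j) :
    MeasurableSet[R.before t j] (R.passes t k) := by
  have : MeasurableSpace.generateFrom {R.passes t k} ≤ R.before t j :=
    (le_sup_right.trans (le_iSup₂ (f := fun (k : Fin N) (_ : k < j) =>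
      (MeasurableSpace.comap (R.rate t k) inferInstance ⊔
      MeasurableSpace.generateFrom {R.passes t k})) k h)).trans le_sup_right
  exact this _ (MeasurableSpace.measurableSet_generateFrom rfl)

theorem measurable_p_beforeDraft (t : ℕ) (j : Fin N) (x : V) :
    Measurable[R.beforeDraft t j] fun ω => R.p t j ω x := by
  have : MeasurableSpace.comap (R.p t j) inferInstance ≤ R.beforeDraft t j :=
    le_sup_right.trans le_sup_left
  exact (measurable_pi_apply x).comp ((comap_measurable (R.p t j)).mono this le_rfl)

theorem measurable_q_beforeDraft (t : ℕ) (j : Fin N) (x : V) :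
    Measurable[R.beforeDraft t j] fun ω => R.q t j ω x := by
  have : MeasurableSpace.comap (R.q t j) inferInstance ≤ R.beforeDraft t j := le_sup_right
  exact (measurable_pi_apply x).comp ((comap_measurable (R.q t j)).mono this le_rfl)

/-- The event that the first `n` drafted tokens of round `t` pass. -/
def passesFirst (t n : ℕ) : Set R.Ω := {ω | ∀ k : Fin N, (k : ℕ) < n → ω ∈ R.passes t k}

theorem passesFirst_succ (t : ℕ) (j : Fin N) :
    R.passesFirst t (j + 1) = R.passesFirst t j ∩ R.passes t j := by
  ext ω
  constructor
  · exact fun h => ⟨fun k hk => h k (by omega), h j (by omega)⟩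
  · rintro ⟨h1, h2⟩ k hk
    rcases Nat.lt_succ_iff_lt_or_eq.1 hk with h | h
    · exact h1 k h
    · rwa [Fin.ext h]

theorem measurableSet_passesFirst_before (t : ℕ) (j : Fin N) :
    MeasurableSet[R.before t j] (R.passesFirst t j) := by
  have : R.passesFirst t j = ⋂ k : Fin N, ⋂ _ : k < j, R.passes t k := by
    ext ω; simp only [passesFirst, Set.mem_iInter]; rfl
  rw [this]
  exact MeasurableSet.iInter fun k => MeasurableSet.iInter fun h =>
    R.measurableSet_passes_before t h

namespace IsStationarySD

variable {R} {ν : Fin K → Measure ℝ} {α : Fin K → ℝ}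

theorem measurableSet_arm (H : R.IsStationarySD ν) (t : ℕ) (i : Fin K) :
    MeasurableSet[R.ℱ t] {ω | R.arm t ω = i} :=
  H.measurable_arm t (measurableSet_singleton i)

theorem measurableSet_arm_top (H : R.IsStationarySD ν) (t : ℕ) (i : Fin K) :
    MeasurableSet {ω | R.arm t ω = i} := R.ℱ.le t _ (H.measurableSet_arm t i)

theorem measurable_comp_arm (H : R.IsStationarySD ν) (t : ℕ) (f : Fin K → ℝ) :
    Measurable[R.ℱ t] fun ω => f (R.arm t ω) :=
  (measurable_of_finite f).comp (H.measurable_arm t)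

theorem setIntegral_eq_sum_arm (H : R.IsStationarySD ν) (t : ℕ) {f : R.Ω → ℝ}
    (hf : Integrable f R.μ) (E : Set R.Ω) :
    ∫ ω in E, f ω ∂(R.μ) = ∑ i, ∫ ω in E ∩ {ω | R.arm t ω = i}, f ω ∂(R.μ) := by
  classical
  have : f = fun ω => ∑ i, {ω | R.arm t ω = i}.indicator f ω := by
    ext ω; simp [Set.indicator_apply]
  conv_lhs => rw [this]
  rw [integral_finsetSum _ fun i _ => (hf.indicator (H.measurableSet_arm_top t i)).integrableOn]
  exact Finset.sum_congr rfl fun i _ => setIntegral_indicator (H.measurableSet_arm_top t i)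

/-- On a past event inside `{arm = i}`, `rate_law` says that the rate pushes the restricted measure
to a multiple of `ν i`; the integral is then a change of variables. -/
theorem setIntegral_comp_rate (H : R.IsStationarySD ν) (t : ℕ) (j : Fin N) (i : Fin K)
    {E : Set R.Ω} (hE : MeasurableSet[R.before t j] E) {f : ℝ → ℝ} (hf : Measurable f) :
    ∫ ω in E ∩ {ω | R.arm t ω = i}, f (R.rate t j ω) ∂(R.μ) =
      R.μ.real (E ∩ {ω | R.arm t ω = i}) * ∫ x, f x ∂(ν i) := by
  set E' := E ∩ {ω | R.arm t ω = i}
  have hE' : MeasurableSet[R.before t j] E' :=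
    hE.inter (R.filtration_le_before t j _ (H.measurableSet_arm t i))
  have hmap : (R.μ.restrict E').map (R.rate t j) = R.μ E' • ν i := by
    ext S hS
    rw [Measure.map_apply (H.measurable_rate_top t j) hS,
      Measure.restrict_apply (H.measurable_rate_top t j hS), Set.inter_comm,
      H.rate_law t j i E' hE' (fun ω h => h.2) S hS]
    rfl
  rw [← integral_map (H.measurable_rate_top t j).aemeasurable hf.aestronglyMeasurable, hmap,
    integral_smul_measure]
  rfl

theorem integrable_of_bound (H : R.IsStationarySD ν) {f : R.Ω → ℝ} (hf : Measurable f) {C : ℝ}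
    (hC : ∀ ω, |f ω| ≤ C) : Integrable f R.μ := by
  have := H.isProbabilityMeasure
  exact Integrable.of_bound hf.aestronglyMeasurable C (Eventually.of_forall hC)

theorem integrable_comp_arm (H : R.IsStationarySD ν) (t : ℕ) (f : Fin K → ℝ) :
    Integrable (fun ω => f (R.arm t ω)) R.μ :=
  H.integrable_of_bound (C := ∑ i, |f i|) ((H.measurable_comp_arm t f).mono (R.ℱ.le t) le_rfl)
    fun ω => Finset.single_le_sum (f := fun i => |f i|) (fun _ _ => abs_nonneg _)
      (Finset.mem_univ (R.arm t ω))

theorem setIntegral_rate (H : R.IsStationarySD ν) (hα : ∀ i, α i = ∫ x, x ∂(ν i)) (t : ℕ)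
    (j : Fin N) {E : Set R.Ω} (hE : MeasurableSet[R.before t j] E) :
    ∫ ω in E, R.rate t j ω ∂(R.μ) = ∫ ω in E, α (R.arm t ω) ∂(R.μ) := by
  have h1 : Integrable (R.rate t j) R.μ := H.integrable_of_bound (C := 1)
    (H.measurable_rate_top t j) fun ω => by
      have := H.rate_mem_Icc t j ω
      rw [abs_of_nonneg this.1]; exact this.2
  rw [H.setIntegral_eq_sum_arm t h1, H.setIntegral_eq_sum_arm t (H.integrable_comp_arm t α)]
  refine Finset.sum_congr rfl fun i _ => ?_
  rw [H.setIntegral_comp_rate t j i hE (f := fun x => x) measurable_id, ← hα,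
    setIntegral_congr_fun (g := fun _ => α i) ((H.before_le t j _ hE).inter
      (H.measurableSet_arm_top t i)) fun ω hω => by
        have : R.arm t ω = i := hω.2
        simp [this]]
  simp

/-- Split by the drafted token `x`. The uniform variable accepts it with probability `min 1 (p /
q)`, `token_law` weights this by `q`, and the products `min p q` sum to the rate, whose conditional
mean is `α` of the selected drafter. -/
theorem measureReal_inter_passes [MeasurableSingletonClass V] (H : R.IsStationarySD ν)
    (hα : ∀ i, α i = ∫ x, x ∂(ν i)) (t : ℕ) (j : Fin N) {E : Set R.Ω}
    (hE : MeasurableSet[R.before t j] E) :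
    R.μ.real (E ∩ R.passes t j) = ∫ ω in E, α (R.arm t ω) ∂(R.μ) := by
  have := H.isProbabilityMeasure
  have hle := H.beforeDraft_le t j
  have hED : MeasurableSet[R.beforeDraft t j] E := R.before_le_beforeDraft t j _ hE
  have hEΩ := hle _ hED
  set c : V → R.Ω → ℝ := fun x ω => min 1 (R.p t j ω x / R.q t j ω x) with hc
  have hcm : ∀ x, Measurable[R.beforeDraft t j] (c x) := fun x =>
    measurable_const.min ((R.measurable_p_beforeDraft t j x).div
      (R.measurable_q_beforeDraft t j x))
  have hc0 : ∀ x ω, 0 ≤ c x ω := fun x ω => le_min zero_le_one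
    (div_nonneg ((H.p_mem t j ω).1 x) ((H.q_mem t j ω).1 x))
  have hc1 : ∀ x ω, c x ω ≤ 1 := fun x ω => min_le_left _ _
  have htok : ∀ x, MeasurableSet {ω | R.token t j ω = x} := fun x =>
    H.measurable_token t j (measurableSet_singleton x)
  have hpass : ∀ x, R.μ.real ((E ∩ {ω | R.token t j ω = x}) ∩ R.passes t j) =
      ∫ ω in E, min (R.p t j ω x) (R.q t j ω x) ∂(R.μ) := by
    intro x
    have h1 : (E ∩ {ω | R.token t j ω = x}) ∩ R.passes t j =
        (E ∩ {ω | R.token t j ω = x}) ∩ {ω | R.u t j ω ≤ c x ω} := by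
      ext ω
      simp only [Set.mem_inter_iff, Set.mem_ofPred_eq, passes, hc]
      refine and_congr_right fun h => ?_
      rw [h.2]
    have h2 := measureReal_inter_uniform_le (m := R.beforeDraft t j ⊔
      MeasurableSpace.comap (R.token t j) inferInstance)
      (sup_le hle (H.measurable_token t j).comap_le) (H.measurable_u t j) (H.u_law t j)
      (H.u_indep t j) ((hcm x).mono le_sup_left le_rfl) (hc0 x) (hc1 x)
      (E := E ∩ {ω | R.token t j ω = x})
      (MeasurableSet.inter ((le_sup_left : R.beforeDraft t j ≤ _) _ hED)
        ((le_sup_right : MeasurableSpace.comap (R.token t j) inferInstance ≤ _) _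
          ⟨{x}, measurableSet_singleton x, rfl⟩))
    rw [h1, h2, ← setIntegral_indicator (htok x), ← integral_indicator hEΩ]
    have hq : Integrable (fun ω => R.q t j ω x) R.μ := H.integrable_of_bound (C := 1)
      ((R.measurable_q_beforeDraft t j x).mono hle le_rfl) fun ω => by
        rw [abs_of_nonneg ((H.q_mem t j ω).1 x)]
        exact (mem_Icc_of_mem_stdSimplex (H.q_mem t j ω) x).2
    have h3 := integral_mul_eq_of_forall_setIntegral_eq hle (C := 1)
      (f := {ω | R.token t j ω = x}.indicator fun _ => (1 : ℝ)) (g := fun ω => R.q t j ω x)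
      (Z := E.indicator (c x)) ((integrable_const 1).indicator (htok x)) hq
      (fun F hF => by
        rw [← H.token_law t j x F hF, setIntegral_indicator (htok x)]
        simp)
      ((hcm x).indicator hED) (fun ω => by
        by_cases h : ω ∈ E
        · simpa [h, abs_of_nonneg (hc0 x ω)] using hc1 x ω
        · simp [h])
    rw [← integral_indicator hEΩ]
    convert h3 using 3 with ω ω
    · by_cases h : ω ∈ E <;> by_cases h' : R.token t j ω = x <;> simp [h, h']
    · by_cases h : ω ∈ E
      · simp only [h, Set.indicator_of_mem]
        rw [mul_comm, mul_min_one_div ((H.p_mem t j ω).1 x) ((H.q_mem t j ω).1 x)]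
      · simp [h]
  have hmin : ∀ x, Integrable (fun ω => min (R.p t j ω x) (R.q t j ω x)) R.μ := fun x =>
    H.integrable_of_bound (C := 1) (((R.measurable_p_beforeDraft t j x).min
      (R.measurable_q_beforeDraft t j x)).mono hle le_rfl) fun ω => by
        rw [abs_of_nonneg (le_min ((H.p_mem t j ω).1 x) ((H.q_mem t j ω).1 x))]
        exact (min_le_right _ _).trans (mem_Icc_of_mem_stdSimplex (H.q_mem t j ω) x).2
  have hunion : E ∩ R.passes t j = ⋃ x, (E ∩ {ω | R.token t j ω = x}) ∩ R.passes t j := by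
    ext ω; simp [and_assoc]
  rw [← H.setIntegral_rate hα t j hE, hunion, measureReal_iUnion_fintype]
  · simp only [hpass, rate]
    rw [← integral_finsetSum _ fun x _ => (hmin x).integrableOn]
    exact integral_congr_ae (Eventually.of_forall fun ω =>
      (one_sub_tvDist (H.p_mem t j ω) (H.q_mem t j ω)).symm)
  · intro x y hxy
    refine Set.disjoint_left.2 fun ω h1 h2 => hxy ?_
    exact h1.1.2.symm.trans h2.1.2
  · exact fun x => (hEΩ.inter (htok x)).inter (H.measurableSet_passes_top t j)

theorem measurableSet_passesFirst (H : R.IsStationarySD ν) (t n : ℕ) :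
    MeasurableSet[R.ℱ (t + 1)] (R.passesFirst t n) := by
  have : R.passesFirst t n = ⋂ k : Fin N, ⋂ _ : (k : ℕ) < n, R.passes t k := by
    ext ω; simp [passesFirst]
  rw [this]
  exact MeasurableSet.iInter fun k => MeasurableSet.iInter fun _ => H.measurableSet_passes t k

/-- Each position contributes one conditional factor `α`, last position first. The weight `Z` is
general so that the induction hypothesis can absorb the factor produced at the last position. -/
theorem integral_mul_passesFirst [MeasurableSingletonClass V] (H : R.IsStationarySD ν)
    (hα : ∀ i, α i = ∫ x, x ∂(ν i)) (hα01 : ∀ i, α i ∈ Set.Icc (0 : ℝ) 1) (t : ℕ) {n : ℕ}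
    (hn : n ≤ N) : ∀ {Z : R.Ω → ℝ} {C : ℝ}, Measurable[R.ℱ t] Z → (∀ ω, |Z ω| ≤ C) →
    ∫ ω, Z ω * (R.passesFirst t n).indicator 1 ω ∂(R.μ) =
      ∫ ω, Z ω * α (R.arm t ω) ^ n ∂(R.μ) := by
  have := H.isProbabilityMeasure
  have hpΩ : ∀ n, MeasurableSet (R.passesFirst t n) := fun n =>
    R.ℱ.le _ _ (H.measurableSet_passesFirst t n)
  induction n with
  | zero =>
    intro Z C _ _
    simp [passesFirst]
  | succ n ih =>
    intro Z C hZ hC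
    set j : Fin N := ⟨n, hn⟩
    refine integral_mul_eq_of_forall_setIntegral_eq (R.ℱ.le t)
      (((integrable_const (1 : ℝ)).indicator (hpΩ _)))
      (H.integrable_comp_arm t fun i => α i ^ (n + 1)) (fun E hE => ?_) hZ hC
    have hEΩ := R.ℱ.le t _ hE
    have hB : MeasurableSet[R.before t j] (E ∩ R.passesFirst t n) :=
      (R.filtration_le_before t j _ hE).inter (R.measurableSet_passesFirst_before t j)
    have h1 := H.measureReal_inter_passes hα t j hB
    -- The drafter is known before the round, so `α (arm)` together with the indicator of `E` is an
    -- admissible weight.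
    have h2 := ih (by omega) (Z := E.indicator fun ω => α (R.arm t ω)) (C := 1)
      ((H.measurable_comp_arm t α).indicator hE) (fun ω => by
        by_cases h : ω ∈ E
        · simpa [h, abs_of_nonneg (hα01 _).1] using (hα01 _).2
        · simp [h])
    rw [setIntegral_indicator (hpΩ _), (R.passesFirst_succ t j : R.passesFirst t (n + 1) = _),
      ← Set.inter_assoc]
    simp only [Pi.one_apply, integral_const, MeasurableSet.univ, measureReal_restrict_apply,
      Set.univ_inter, smul_eq_mul, mul_one]
    rw [h1, ← setIntegral_indicator (hpΩ n), ← integral_indicator hEΩ, ← integral_indicator hEΩ]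
    convert h2 using 3 with ω ω
    · by_cases h : ω ∈ E <;> by_cases h' : ω ∈ R.passesFirst t n <;> simp [h, h']
    · by_cases h : ω ∈ E <;> simp [h, pow_succ']

end IsStationarySD

end Run

/-! ### An exponential supermartingale for the rewards of one drafter. -/

/-- Hoeffding's lemma for a probability measure on the unit interval. -/
theorem integral_exp_sub_mean_le_one {ρ : Measure ℝ} [IsProbabilityMeasure ρ]
    (hρ : ∀ᵐ x ∂ρ, x ∈ Set.Icc (0 : ℝ) 1) {a : ℝ} (ha : a = ∫ x, x ∂ρ) (θ : ℝ) :
    ∫ x, Real.exp (θ * (x - a) - θ ^ 2 / 8) ∂ρ ≤ 1 := by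
  have h := (hasSubgaussianMGF_of_mem_Icc (μ := ρ) (X := fun x => x) aemeasurable_id hρ).mgf_le θ
  rw [mgf, ← ha] at h
  simp only [Real.exp_sub]
  rw [integral_div, div_le_one (Real.exp_pos _)]
  refine h.trans_eq ?_
  congr 1
  norm_num
  ring

namespace Run

variable {K N : ℕ} {V : Type v} [Fintype V] [MeasurableSpace V] {R : Run.{u, v} K N V}

variable (R) in
/-- The total deviation of the block divergence rewards of drafter `i` from `a` in the first `n`
rounds. -/
noncomputable def excess (i : Fin K) (a : ℝ) (n : ℕ) (ω : R.Ω) : ℝ :=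
  ∑ s ∈ (Finset.range n).filter (fun s => R.arm s ω = i), (R.bdReward s ω - a)

theorem excess_succ (i : Fin K) (a : ℝ) (n : ℕ) (ω : R.Ω) :
    R.excess i a (n + 1) ω =
      R.excess i a n ω + if R.arm n ω = i then R.bdReward n ω - a else 0 := by
  unfold excess
  rw [Finset.sum_filter, Finset.sum_filter, Finset.sum_range_succ]

theorem pulls_succ (i : Fin K) (n : ℕ) (ω : R.Ω) :
    R.pulls i (n + 1) ω = R.pulls i n ω + if R.arm n ω = i then 1 else 0 := by
  unfold pulls
  rw [Finset.card_filter, Finset.card_filter, Finset.sum_range_succ]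

theorem pulls_le (i : Fin K) (n : ℕ) (ω : R.Ω) : R.pulls i n ω ≤ n :=
  (Finset.card_filter_le _ _).trans (Finset.card_range n).le

/-- Working with `excess` avoids dividing by a random count. If there are no selections both sides
vanish, whatever default `empMean` takes. -/
theorem excess_eq_pulls_mul (i : Fin K) (a : ℝ) (n : ℕ) (ω : R.Ω) :
    R.excess i a n ω = R.pulls i n ω * (R.empMean i n ω - a) := by
  rcases Nat.eq_zero_or_pos (R.pulls i n ω) with h | h
  · have : (Finset.range n).filter (fun s => R.arm s ω = i) = ∅ := Finset.card_eq_zero.1 h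
    simp [excess, this, h]
  · have h' : (R.pulls i n ω : ℝ) ≠ 0 := by positivity
    rw [excess, empMean, mul_sub, mul_div_cancel₀ _ h', Finset.sum_sub_distrib]
    simp [pulls]

namespace IsStationarySD

variable {ν : Fin K → Measure ℝ} {α : Fin K → ℝ}

theorem bdReward_mem_Icc (H : R.IsStationarySD ν) (hN : 1 ≤ N) (t : ℕ) (ω : R.Ω) :
    R.bdReward t ω ∈ Set.Icc (0 : ℝ) 1 := by
  have hN' : (0 : ℝ) < N := by exact_mod_cast hN
  have h : ∑ j, R.rate t j ω ≤ N := by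
    simpa using Finset.sum_le_sum fun j (_ : j ∈ Finset.univ) => (H.rate_mem_Icc t j ω).2
  have h0 : 0 ≤ ∑ j, R.rate t j ω := Finset.sum_nonneg fun j _ => (H.rate_mem_Icc t j ω).1
  constructor
  · unfold bdReward; positivity
  · rw [bdReward, one_div, inv_mul_le_iff₀ hN']; simpa using h

theorem measurable_bdReward (H : R.IsStationarySD ν) (t : ℕ) :
    Measurable[R.ℱ (t + 1)] (R.bdReward t) :=
  (Finset.measurable_sum _ fun j _ => H.measurable_rate t j).const_mul _

theorem measurable_excess (H : R.IsStationarySD ν) (i : Fin K) (a : ℝ) (n : ℕ) :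
    Measurable[R.ℱ n] (R.excess i a n) := by
  induction n with
  | zero =>
    have : R.excess i a 0 = fun _ => 0 := by ext; simp [excess]
    rw [this]; exact measurable_const
  | succ n ih =>
    rw [funext (excess_succ i a n)]
    exact (ih.mono (R.ℱ.mono n.le_succ) le_rfl).add
      (Measurable.ite (R.ℱ.mono n.le_succ _ (H.measurableSet_arm n i))
        ((H.measurable_bdReward n).sub measurable_const) measurable_const)

theorem measurable_pulls (H : R.IsStationarySD ν) (i : Fin K) (n : ℕ) :
    Measurable[R.ℱ n] fun ω => (R.pulls i n ω : ℝ) := by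
  induction n with
  | zero => simp [pulls]
  | succ n ih =>
    simp only [pulls_succ, Nat.cast_add, Nat.cast_ite, Nat.cast_one, Nat.cast_zero]
    exact (ih.mono (R.ℱ.mono n.le_succ) le_rfl).add
      (Measurable.ite (R.ℱ.mono n.le_succ _ (H.measurableSet_arm n i))
        measurable_const measurable_const)

theorem abs_excess_le (H : R.IsStationarySD ν) (hN : 1 ≤ N) (i : Fin K) {a : ℝ}
    (ha : a ∈ Set.Icc (0 : ℝ) 1) (n : ℕ) (ω : R.Ω) : |R.excess i a n ω| ≤ n := by
  refine (Finset.abs_sum_le_sum_abs _ _).trans ?_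
  refine (Finset.sum_le_card_nsmul _ _ 1 fun s _ => ?_).trans ?_
  · have := H.bdReward_mem_Icc hN s ω
    rw [abs_le]; constructor <;> linarith [this.1, this.2, ha.1, ha.2]
  · rw [nsmul_one]; exact_mod_cast R.pulls_le i n ω

/-- On `{arm = i}` the fresh rate has law `ν i`, so by Hoeffding the factor averages to at most one;
elsewhere it equals one. -/
theorem integral_mul_exp_rate_le (H : R.IsStationarySD ν) {i : Fin K}
    [IsProbabilityMeasure (ν i)] (hν : ∀ᵐ x ∂(ν i), x ∈ Set.Icc (0 : ℝ) 1) {a : ℝ}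
    (ha : a = ∫ x, x ∂(ν i)) (θ : ℝ) (t : ℕ) (j : Fin N) {Z : R.Ω → ℝ} {C : ℝ}
    (hZ : Measurable[R.before t j] Z) (hZ0 : ∀ ω, 0 ≤ Z ω) (hZC : ∀ ω, Z ω ≤ C)
    (ha01 : a ∈ Set.Icc (0 : ℝ) 1) :
    ∫ ω, Z ω * Real.exp (if R.arm t ω = i then θ * (R.rate t j ω - a) - θ ^ 2 / 8 else 0) ∂(R.μ)
      ≤ ∫ ω, Z ω ∂(R.μ) := by
  classical
  have := H.isProbabilityMeasure
  have hle := H.before_le t j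
  set I : ℝ := ∫ x, Real.exp (θ * (x - a) - θ ^ 2 / 8) ∂(ν i)
  have hI1 : I ≤ 1 := integral_exp_sub_mean_le_one hν ha θ
  have hI0 : 0 ≤ I := integral_nonneg fun _ => (Real.exp_pos _).le
  set g : Fin K → ℝ := fun k => if k = i then I else 1
  set f : R.Ω → ℝ := fun ω =>
    Real.exp (if R.arm t ω = i then θ * (R.rate t j ω - a) - θ ^ 2 / 8 else 0)
  have hfm : Measurable f := (Measurable.ite (H.measurableSet_arm_top t i)
    ((((H.measurable_rate_top t j).sub measurable_const).const_mul θ).sub measurable_const)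
    measurable_const).exp
  have hf : Integrable f R.μ := H.integrable_of_bound (C := Real.exp |θ|) hfm fun ω => by
    rw [abs_of_pos (Real.exp_pos _), Real.exp_le_exp]
    split_ifs
    · have h1 := H.rate_mem_Icc t j ω
      have h2 : |R.rate t j ω - a| ≤ 1 := by
        rw [abs_le]; constructor <;> linarith [h1.1, h1.2, ha01.1, ha01.2]
      have h3 : θ * (R.rate t j ω - a) ≤ |θ| * 1 := (le_abs_self _).trans (by
        rw [abs_mul]; gcongr)
      nlinarith [sq_nonneg θ]
    · exact abs_nonneg θ
  have h1 : ∫ ω, Z ω * f ω ∂(R.μ) = ∫ ω, Z ω * g (R.arm t ω) ∂(R.μ) := by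
    refine integral_mul_eq_of_forall_setIntegral_eq hle (C := C) hf (H.integrable_comp_arm t g)
      (fun E hE => ?_) hZ fun ω => by rw [abs_of_nonneg (hZ0 ω)]; exact hZC ω
    rw [H.setIntegral_eq_sum_arm t hf, H.setIntegral_eq_sum_arm t (H.integrable_comp_arm t g)]
    refine Finset.sum_congr rfl fun k _ => ?_
    have hm : MeasurableSet (E ∩ {ω | R.arm t ω = k}) :=
      (hle _ hE).inter (H.measurableSet_arm_top t k)
    by_cases hk : k = i
    · subst hk
      rw [setIntegral_congr_fun (f := f) (g := fun ω =>
          (fun x => Real.exp (θ * (x - a) - θ ^ 2 / 8)) (R.rate t j ω)) hm fun ω hω => by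
            have : R.arm t ω = k := hω.2
            simp [f, this],
        H.setIntegral_comp_rate t j k hE (f := fun x => Real.exp (θ * (x - a) - θ ^ 2 / 8))
          (by fun_prop),
        setIntegral_congr_fun (g := fun _ => I) hm fun ω hω => by
            have : R.arm t ω = k := hω.2
            simp [g, this]]
      simp [I]
    · refine setIntegral_congr_fun hm fun ω hω => ?_
      have : R.arm t ω = k := hω.2
      simp [f, g, this, hk]
  have hZint : Integrable Z R.μ := H.integrable_of_bound (C := C) (hZ.mono hle le_rfl) fun ω => by
    rw [abs_of_nonneg (hZ0 ω)]; exact hZC ω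
  have hg1 : ∀ k, g k ≤ 1 := fun k => by simp only [g]; split_ifs <;> linarith
  have hg0 : ∀ k, 0 ≤ g k := fun k => by simp only [g]; split_ifs <;> linarith
  rw [h1]
  refine integral_mono_of_nonneg (Eventually.of_forall fun ω => mul_nonneg (hZ0 ω) (hg0 _)) hZint
    (Eventually.of_forall fun ω => ?_)
  exact mul_le_of_le_one_right (hZ0 ω) (hg1 _)

theorem integral_mul_exp_sum_rate_le (H : R.IsStationarySD ν) {i : Fin K}
    [IsProbabilityMeasure (ν i)] (hν : ∀ᵐ x ∂(ν i), x ∈ Set.Icc (0 : ℝ) 1) {a : ℝ}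
    (ha : a = ∫ x, x ∂(ν i)) (ha01 : a ∈ Set.Icc (0 : ℝ) 1) (θ : ℝ) (t : ℕ) {n : ℕ} (hn : n ≤ N)
    {Z : R.Ω → ℝ} {C : ℝ} (hZ : Measurable[R.ℱ t] Z) (hZ0 : ∀ ω, 0 ≤ Z ω)
    (hZC : ∀ ω, Z ω ≤ C) :
    ∫ ω, Z ω * Real.exp (∑ k : Fin N with k.val < n,
        if R.arm t ω = i then θ * (R.rate t k ω - a) - θ ^ 2 / 8 else 0) ∂(R.μ)
      ≤ ∫ ω, Z ω ∂(R.μ) := by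
  induction n with
  | zero => simp
  | succ n ih =>
    set j : Fin N := ⟨n, hn⟩
    refine le_trans ?_ (ih (by omega))
    have hfil : (Finset.univ.filter fun k : Fin N => k.val < n + 1) =
        insert j (Finset.univ.filter fun k : Fin N => k.val < n) := by
      ext k
      simp only [Finset.mem_filter, Finset.mem_univ, true_and, Finset.mem_insert, Fin.ext_iff, j]
      omega
    have hnot : j ∉ Finset.univ.filter fun k : Fin N => k.val < n := by simp [j]
    rw [hfil]
    simp only [Finset.sum_insert hnot, Real.exp_add]
    have hbound : ∀ ω k, (if R.arm t ω = i then θ * (R.rate t k ω - a) - θ ^ 2 / 8 else 0)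
        ≤ |θ| := by
      intro ω k
      split_ifs
      · have h1 := H.rate_mem_Icc t k ω
        have h2 : |R.rate t k ω - a| ≤ 1 := by
          rw [abs_le]; constructor <;> linarith [h1.1, h1.2, ha01.1, ha01.2]
        have h3 : θ * (R.rate t k ω - a) ≤ |θ| * 1 := (le_abs_self _).trans (by
          rw [abs_mul]; gcongr)
        nlinarith [sq_nonneg θ]
      · exact abs_nonneg θ
    refine le_of_eq_of_le ?_ (H.integral_mul_exp_rate_le hν ha θ t j
      (Z := fun ω => Z ω * Real.exp (∑ k : Fin N with k.val < n,
        if R.arm t ω = i then θ * (R.rate t k ω - a) - θ ^ 2 / 8 else 0))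
      (C := C * Real.exp (N * |θ|)) ?_ (fun ω => mul_nonneg (hZ0 ω) (Real.exp_pos _).le)
      (fun ω => ?_) ha01)
    · congr 1; ext ω; ring
    · refine (hZ.mono (R.filtration_le_before t j) le_rfl).mul (Measurable.exp ?_)
      refine Finset.measurable_sum _ fun k hk => ?_
      have hk' : k < j := by simpa [j, Fin.lt_def] using (Finset.mem_filter.1 hk).2
      exact Measurable.ite (R.filtration_le_before t j _ (H.measurableSet_arm t i))
        ((((R.measurable_rate_before t hk').sub measurable_const).const_mul θ).sub
          measurable_const) measurable_const
    · refine mul_le_mul (hZC ω) (Real.exp_le_exp.2 ?_) (Real.exp_pos _).le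
        ((hZ0 ω).trans (hZC ω))
      refine (Finset.sum_le_card_nsmul _ _ _ fun k _ => hbound ω k).trans ?_
      rw [nsmul_eq_mul]
      gcongr
      exact_mod_cast (Finset.card_filter_le _ _).trans (by simp)

/-- A round of drafter `i` multiplies the exponential by `N` one-position factors with parameter `l
/ N`. Their compensators add up to `N (l / N) ^ 2 / 8 = l ^ 2 / (8 N)`, which is the gain from
averaging over a block. The sign of `l` is free, so both tails are covered. -/
theorem integral_exp_excess_le_one (H : R.IsStationarySD ν) (hN : 1 ≤ N) {i : Fin K}
    [IsProbabilityMeasure (ν i)] (hν : ∀ᵐ x ∂(ν i), x ∈ Set.Icc (0 : ℝ) 1) {a : ℝ}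
    (ha : a = ∫ x, x ∂(ν i)) (ha01 : a ∈ Set.Icc (0 : ℝ) 1) (l : ℝ) (n : ℕ) :
    ∫ ω, Real.exp (l * R.excess i a n ω - l ^ 2 / (8 * N) * R.pulls i n ω) ∂(R.μ) ≤ 1 := by
  have := H.isProbabilityMeasure
  have hN' : (N : ℝ) ≠ 0 := by positivity
  induction n with
  | zero => simp [excess, pulls]
  | succ n ih =>
    refine le_trans (le_of_eq_of_le ?_ (H.integral_mul_exp_sum_rate_le hν ha ha01 (l / N) n le_rfl
      (Z := fun ω => Real.exp (l * R.excess i a n ω - l ^ 2 / (8 * N) * R.pulls i n ω))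
      (C := Real.exp (|l| * n)) ?_ (fun _ => (Real.exp_pos _).le) fun ω => ?_)) ih
    · congr 1; ext ω
      rw [← Real.exp_add, excess_succ, pulls_succ]
      congr 1
      simp only [Fin.is_lt, Finset.filter_true]
      split_ifs with h
      · rw [Finset.sum_sub_distrib, ← Finset.mul_sum, Finset.sum_sub_distrib, bdReward]
        simp only [Finset.sum_const, Finset.card_univ, Fintype.card_fin, nsmul_eq_mul]
        push_cast
        field_simp
        ring
      · simp
    · exact (((H.measurable_excess i a n).const_mul l).sub
        ((H.measurable_pulls i n).const_mul _)).exp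
    · rw [Real.exp_le_exp]
      have h1 : l * R.excess i a n ω ≤ |l| * n := (le_abs_self _).trans (by
        rw [abs_mul]; gcongr; exact H.abs_excess_le hN i ha01 n ω)
      have h2 : 0 ≤ l ^ 2 / (8 * N) * R.pulls i n ω := by positivity
      linarith

end IsStationarySD

end Run

/-! ### Numerical estimates: power sums, peeling, and the constant in `β`. -/

theorem sum_exp_neg_mul_log_le {s : ℝ} (hs : 0 < s) (n : ℕ) :
    ∑ k ∈ Finset.range n, Real.exp (-(1 + s) * Real.log ((k : ℝ) + 2)) ≤
      (1 - Real.exp (-s * Real.log ((n : ℝ) + 1))) / s := by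
  induction n with
  | zero => simp
  | succ n ih =>
    rw [Finset.sum_range_succ]
    have hx : (0 : ℝ) < n + 1 := by positivity
    have ht : (0 : ℝ) < n + 2 := by positivity
    set l := Real.log ((n : ℝ) + 1)
    set L := Real.log ((n : ℝ) + 2)
    -- Discrete form of comparing the sum with `∫ x ^ (-1 - s)`: this increment of the logarithm
    -- makes the right-hand side telescope.
    have h1 : 1 / ((n : ℝ) + 2) ≤ L - l := by
      have := Real.log_le_sub_one_of_pos (div_pos hx ht)
      rw [Real.log_div hx.ne' ht.ne'] at this
      have h2 : ((n : ℝ) + 1) / (n + 2) - 1 = -(1 / (n + 2)) := by field_simp; ring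
      linarith
    have h2 : Real.exp (-(1 + s) * L) = Real.exp (-s * L) * (1 / ((n : ℝ) + 2)) := by
      rw [show -(1 + s) * L = -s * L + -L by ring, Real.exp_add, Real.exp_neg L,
        Real.exp_log ht, one_div]
    have h3 : Real.exp (-s * L) * (1 + s * (1 / ((n : ℝ) + 2))) ≤ Real.exp (-s * l) := by
      rw [show -s * l = -s * L + s * (L - l) by ring, Real.exp_add]
      refine mul_le_mul_of_nonneg_left ?_ (Real.exp_pos _).le
      have := Real.add_one_le_exp (s * (L - l))
      nlinarith
    have h4 : (1 - Real.exp (-s * Real.log (((n + 1 : ℕ) : ℝ) + 1))) / s =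
        (1 - Real.exp (-s * L)) / s := by
      simp only [L]; push_cast; ring_nf
    have h5 : Real.exp (-s * L) * (1 / ((n : ℝ) + 2)) ≤
        (Real.exp (-s * l) - Real.exp (-s * L)) / s := by
      rw [le_div_iff₀ hs]; nlinarith
    rw [h4, h2]
    calc _ ≤ (1 - Real.exp (-s * l)) / s + (Real.exp (-s * l) - Real.exp (-s * L)) / s :=
          add_le_add ih h5
      _ = _ := by ring

theorem sum_Ico_exp_neg_mul_log_le {s : ℝ} (hs : 0 < s) {K : ℕ} (hK : 2 ≤ K) (B : ℕ) :
    ∑ t ∈ Finset.Ico K B, Real.exp (-(1 + s) * Real.log (t : ℝ)) ≤ 1 / s := by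
  calc _ ≤ ∑ t ∈ Finset.Ico 2 B, Real.exp (-(1 + s) * Real.log (t : ℝ)) :=
        Finset.sum_le_sum_of_subset_of_nonneg (Finset.Ico_subset_Ico_left hK)
          fun _ _ _ => (Real.exp_pos _).le
    _ = ∑ k ∈ Finset.range (B - 2), Real.exp (-(1 + s) * Real.log ((k : ℝ) + 2)) := by
        rw [Finset.sum_Ico_eq_sum_range]
        refine Finset.sum_congr rfl fun k _ => ?_
        push_cast; rw [add_comm (2 : ℝ)]
    _ ≤ _ := sum_exp_neg_mul_log_le hs _
    _ ≤ 1 / s := by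
        gcongr
        linarith [Real.exp_pos (-s * Real.log (((B - 2 : ℕ) : ℝ) + 1))]

/-- The exponent obtained on one slice `y ≤ √n ≤ (1 + δ / 3) y` of the peeling argument. -/
theorem peeling_exponent {δ M b L n y e : ℝ} (hδ : 0 < δ) (hδ' : δ ≤ 3 / 2) (hM : 0 < M)
    (hb : 0 ≤ b) (hbM : 4 * M * b ^ 2 = 1 + 2 * δ) (hL : 0 ≤ L) (hn : 0 ≤ n) (hy : 0 < y)
    (hyn : y ≤ √n) (hny : √n ≤ (1 + δ / 3) * y) (he : b * √(2 * L * n) ≤ e) :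
    (1 + δ) * L ≤ 4 * M * b * √(2 * L) / y * e - (4 * M * b * √(2 * L) / y) ^ 2 / (8 * M) * n := by
  obtain ⟨x, hx⟩ : ∃ x, x = √n / y := ⟨_, rfl⟩
  have hsx : √n = x * y := by rw [hx, div_mul_cancel₀ _ hy.ne']
  have hx1 : 1 ≤ x := by rw [hx, one_le_div hy]; exact hyn
  have hx2 : x ≤ 1 + δ / 3 := by rw [hx, div_le_iff₀ hy]; exact hny
  have hw : √(2 * L) ^ 2 = 2 * L := Real.sq_sqrt (by positivity)
  have hnx : n = (x * y) ^ 2 := by rw [← hsx, Real.sq_sqrt hn]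
  have h1 : (4 * M * b * √(2 * L) / y) ^ 2 / (8 * M) * n = (1 + 2 * δ) * L * x ^ 2 := by
    rw [hnx]
    calc _ = (4 * M * b ^ 2) * (√(2 * L) ^ 2 / 2) * x ^ 2 := by field_simp; ring
      _ = _ := by rw [hbM, hw]; ring
  have h2 : (1 + 2 * δ) * (2 * L) * x ≤ 4 * M * b * √(2 * L) / y * e := by
    calc _ = 4 * M * b ^ 2 * √(2 * L) ^ 2 * x := by rw [hbM, hw]
      _ = 4 * M * b * √(2 * L) / y * (b * √(2 * L * n)) := by
          rw [Real.sqrt_mul (show 0 ≤ 2 * L by positivity) n, hsx]; field_simp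
      _ ≤ _ := by gcongr
  rw [h1]
  have h3 : (x - 1) ^ 2 ≤ (δ / 3) ^ 2 := pow_le_pow_left₀ (by linarith) (by linarith) 2
  -- Using `y` in place of `√n` turns the optimal exponent into its multiple by `2 x - x ^ 2 = 1 -
  -- (x - 1) ^ 2`. For `δ ≤ 3 / 2` the mesh `δ / 3` is fine enough to lose at most `δ`.
  have h4 : 1 + δ ≤ (1 + 2 * δ) * (2 * x - x ^ 2) := by
    have : (1 + 2 * δ) * (1 - (δ / 3) ^ 2) ≤ (1 + 2 * δ) * (2 * x - x ^ 2) :=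
      mul_le_mul_of_nonneg_left (by linarith) (by linarith)
    nlinarith [mul_nonneg hδ.le (sub_nonneg.2 hδ'), mul_nonneg (mul_nonneg hδ.le hδ.le) (sub_nonneg.2 hδ')]
  nlinarith [mul_le_mul_of_nonneg_right h4 hL]

theorem exists_pow_slice {δ : ℝ} (hδ : 0 < δ) {n t : ℕ} (hn : 1 ≤ n)
    (hnt : n ≤ t) : ∃ k < ⌊Real.log t / (2 * Real.log (1 + δ / 3))⌋₊ + 1,
      (1 + δ / 3) ^ k ≤ √(n : ℝ) ∧ √(n : ℝ) ≤ (1 + δ / 3) * (1 + δ / 3) ^ k := by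
  have hr : 1 < 1 + δ / 3 := by linarith
  have hn' : (1 : ℝ) ≤ n := by exact_mod_cast hn
  obtain ⟨k, hk1, hk2⟩ := exists_nat_pow_near (Real.one_le_sqrt.2 hn') hr
  refine ⟨k, Nat.lt_succ_of_le (Nat.le_floor ?_), hk1, ?_⟩
  · have h1 : (1 + δ / 3) ^ k ≤ √(t : ℝ) := hk1.trans (Real.sqrt_le_sqrt (by exact_mod_cast hnt))
    have h2 := Real.log_le_log (by positivity) h1
    rw [Real.log_pow, Real.log_sqrt (by positivity)] at h2
    rw [le_div_iff₀ (by have := Real.log_pos hr; positivity)]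
    linarith
  · rw [← pow_succ']; exact hk2.le

/-- The number of slices grows only linearly in `L = log t`, so `exp (δ L / 2)` absorbs it and half
of the surplus `δ` in the exponent survives. The constant `7` is generous; `9 / 2` would do. -/
theorem slice_count_mul_exp_le {δ : ℝ} (hδ : 0 < δ) (hδ' : δ ≤ 3 / 2) {L : ℝ} (hL : 0 ≤ L) :
    ((⌊L / (2 * Real.log (1 + δ / 3))⌋₊ + 1 : ℕ) : ℝ) * Real.exp (-((1 + δ) * L)) ≤
      7 / δ ^ 2 * Real.exp (-(1 + δ / 2) * L) := by
  have hlog : 2 * δ / 9 ≤ Real.log (1 + δ / 3) := by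
    refine le_trans ?_ (Real.one_sub_inv_le_log_of_pos (by positivity))
    have : 1 - (1 + δ / 3)⁻¹ = δ / (3 + δ) := by field_simp; ring
    rw [this, div_le_div_iff₀ (by norm_num) (by positivity)]
    nlinarith
  have h1 : ((⌊L / (2 * Real.log (1 + δ / 3))⌋₊ + 1 : ℕ) : ℝ) ≤ 1 + 9 / (4 * δ) * L := by
    push_cast
    have : (⌊L / (2 * Real.log (1 + δ / 3))⌋₊ : ℝ) ≤ L / (2 * Real.log (1 + δ / 3)) :=
      Nat.floor_le (div_nonneg hL (by linarith))
    have h2 : L / (2 * Real.log (1 + δ / 3)) ≤ L / (2 * (2 * δ / 9)) := by gcongr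
    have h3 : L / (2 * (2 * δ / 9)) = 9 / (4 * δ) * L := by field_simp; ring
    linarith
  have h2 : δ / 2 * L + 1 ≤ Real.exp (δ / 2 * L) := Real.add_one_le_exp _
  have h3 : 1 + 9 / (4 * δ) * L ≤ 7 / δ ^ 2 * Real.exp (δ / 2 * L) := by
    refine le_trans ?_ (mul_le_mul_of_nonneg_left h2 (by positivity))
    have h4 : 7 / δ ^ 2 * (δ / 2 * L + 1) - (1 + 9 / (4 * δ) * L) =
        5 / (4 * δ) * L + (7 - δ ^ 2) / δ ^ 2 := by field_simp; ring
    have h5 : 0 ≤ (7 - δ ^ 2) / δ ^ 2 := div_nonneg (by nlinarith) (by positivity)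
    have h6 : 0 ≤ 5 / (4 * δ) * L := by positivity
    linarith
  calc _ ≤ 7 / δ ^ 2 * Real.exp (δ / 2 * L) * Real.exp (-((1 + δ) * L)) := by
        gcongr; exact h1.trans h3
    _ = _ := by rw [mul_assoc, ← Real.exp_add]; ring_nf

/-- With `δ = 2 β ^ 2 - 1 / 2` the numerator `2 β ^ 2 + 1 / 2` is `1 + δ`, and `log (1 + δ) ≤ δ`.
The cubic lower bound both dominates the deviation sums and forces the blow-up at `β = 1 / 2`. -/
theorem betaConst_lower {β : ℝ} (hβ : 1 / 2 < β) {δ : ℝ} (hδ : δ = 2 * β ^ 2 - 1 / 2) :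
    4 / δ ^ 3 ≤ betaConst β ∧ 1 ≤ betaConst β := by
  have hδ0 : 0 < δ := by rw [hδ]; nlinarith
  have h1 : betaConst β = 1 + 4 / Real.log (1 + δ) * ((1 + δ) / δ) ^ 2 := by
    rw [betaConst, hδ]; ring_nf
  have hlog : 0 < Real.log (1 + δ) := Real.log_pos (by linarith)
  have hlog' : Real.log (1 + δ) ≤ δ := by
    have := Real.log_le_sub_one_of_pos (show 0 < 1 + δ by linarith); linarith
  rw [h1]
  refine ⟨?_, by have : 0 ≤ 4 / Real.log (1 + δ) * ((1 + δ) / δ) ^ 2 := by positivity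
                 linarith⟩
  have h2 : 4 / δ * (1 / δ) ^ 2 ≤ 4 / Real.log (1 + δ) * ((1 + δ) / δ) ^ 2 := by
    gcongr; linarith
  have h3 : 4 / δ * (1 / δ) ^ 2 = 4 / δ ^ 3 := by field_simp
  linarith

theorem tendsto_betaConst : Tendsto betaConst (𝓝[>] (1 / 2)) atTop := by
  have h1 : Tendsto (fun β : ℝ => (2 * β ^ 2 - 1 / 2) ^ 3) (𝓝[>] (1 / 2)) (𝓝[>] 0) := by
    refine tendsto_nhdsWithin_iff.2 ⟨?_, ?_⟩
    · have : ContinuousAt (fun β : ℝ => (2 * β ^ 2 - 1 / 2) ^ 3) (1 / 2) := by fun_prop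
      have h := this.tendsto
      norm_num at h
      exact (by norm_num; exact h.mono_left nhdsWithin_le_nhds)
    · filter_upwards [self_mem_nhdsWithin] with β hβ
      have hβ' : 1 / 2 < β := hβ
      have : 0 < 2 * β ^ 2 - 1 / 2 := by nlinarith
      exact pow_pos this 3
  refine tendsto_atTop_mono' _ ?_ (h1.inv_tendsto_nhdsGT_zero.const_mul_atTop
    (show (0 : ℝ) < 4 by norm_num))
  filter_upwards [self_mem_nhdsWithin] with β hβ
  exact (betaConst_lower hβ rfl).1

/-- The exponents of all the deviation bounds are controlled by the constant of the theorem. -/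
theorem exists_peeling_parameter {β : ℝ} (hβ : 1 / 2 < β) :
    ∃ δ > 0, δ ≤ 3 / 2 ∧ 1 + 2 * δ ≤ 4 * β ^ 2 ∧ 28 / δ ^ 3 ≤ 9 * betaConst β := by
  have hδ0 : 0 < 2 * β ^ 2 - 1 / 2 := by nlinarith
  obtain ⟨h1, h2⟩ := betaConst_lower hβ rfl
  -- Peeling needs `δ ≤ 3 / 2`, so the natural choice is capped there. At the cap `28 / δ ^ 3 = 224
  -- / 27 < 9`, and `betaConst β ≥ 1` suffices.
  rcases le_total (2 * β ^ 2 - 1 / 2) (3 / 2) with h | h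
  · refine ⟨_, hδ0, h, by linarith, ?_⟩
    have : 28 / (2 * β ^ 2 - 1 / 2) ^ 3 = 7 * (4 / (2 * β ^ 2 - 1 / 2) ^ 3) := by ring
    linarith
  · refine ⟨3 / 2, by norm_num, le_rfl, by linarith, ?_⟩
    norm_num
    linarith

/-! ### Deviation inequality at a random number of selections. -/

namespace Run.IsStationarySD

variable {K N : ℕ} {V : Type v} [Fintype V] [MeasurableSpace V] {R : Run.{u, v} K N V}
  {ν : Fin K → Measure ℝ}

theorem measureReal_deviation_le (H : R.IsStationarySD ν) (hN : 1 ≤ N) {i : Fin K}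
    [IsProbabilityMeasure (ν i)] (hν : ∀ᵐ x ∂(ν i), x ∈ Set.Icc (0 : ℝ) 1) {a : ℝ}
    (ha : a = ∫ x, x ∂(ν i)) (ha01 : a ∈ Set.Icc (0 : ℝ) 1) {δ b σ : ℝ} (hδ : 0 < δ)
    (hδ' : δ ≤ 3 / 2) (hb : 0 ≤ b) (hbδ : 1 + 2 * δ ≤ 4 * N * b ^ 2) (hσ : σ ^ 2 = 1) {t : ℕ}
    (ht : 1 ≤ t) :
    R.μ.real {ω | 1 ≤ R.pulls i t ω ∧
        b * √(2 * Real.log t * R.pulls i t ω) ≤ σ * R.excess i a t ω} ≤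
      7 / δ ^ 2 * Real.exp (-(1 + δ / 2) * Real.log t) := by
  have := H.isProbabilityMeasure
  have hN' : (0 : ℝ) < N := by exact_mod_cast hN
  set L := Real.log t with hLdef
  have hL : 0 ≤ L := Real.log_nonneg (by exact_mod_cast ht)
  -- Shrinking the width to make `4 N b' ^ 2 = 1 + 2 δ` exact only enlarges the event.
  set b' := √((1 + 2 * δ) / (4 * N)) with hb'def
  have hb'0 : 0 ≤ b' := Real.sqrt_nonneg _
  have hb'sq : 4 * N * b' ^ 2 = 1 + 2 * δ := by
    rw [hb'def, Real.sq_sqrt (by positivity)]; field_simp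
  have hb'b : b' ≤ b := by
    refine Real.sqrt_le_iff.2 ⟨hb, ?_⟩
    rw [div_le_iff₀ (by positivity)]; linarith
  set m := ⌊L / (2 * Real.log (1 + δ / 3))⌋₊ + 1
  -- The optimal Chernoff parameter for `n` selections, with `√n` replaced by the left end of its
  -- slice so that it is deterministic.
  set l : ℕ → ℝ := fun k => 4 * N * b' * √(2 * L) / (1 + δ / 3) ^ k
  set X : ℕ → R.Ω → ℝ := fun k ω =>
    Real.exp (σ * l k * R.excess i a t ω - (σ * l k) ^ 2 / (8 * N) * R.pulls i t ω)
  set A := {ω | 1 ≤ R.pulls i t ω ∧ b * √(2 * L * R.pulls i t ω) ≤ σ * R.excess i a t ω}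
  have hpm : Measurable fun ω => (R.pulls i t ω : ℝ) :=
    (H.measurable_pulls i t).mono (R.ℱ.le t) le_rfl
  have hem : Measurable (R.excess i a t) := (H.measurable_excess i a t).mono (R.ℱ.le t) le_rfl
  have hXm : ∀ k, Measurable (X k) := fun k => ((hem.const_mul _).sub (hpm.const_mul _)).exp
  have hXint : ∀ k, Integrable (X k) R.μ := fun k =>
    H.integrable_of_bound (C := Real.exp (|σ * l k| * t)) (hXm k) fun ω => by
      rw [abs_of_pos (Real.exp_pos _), Real.exp_le_exp]
      have h1 : σ * l k * R.excess i a t ω ≤ |σ * l k| * t := (le_abs_self _).trans (by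
        rw [abs_mul]; gcongr; exact H.abs_excess_le hN i ha01 t ω)
      have h2 : 0 ≤ (σ * l k) ^ 2 / (8 * N) * R.pulls i t ω := by positivity
      linarith
  have hA : MeasurableSet A := by
    have h1 : A = {ω | (1 : ℝ) ≤ R.pulls i t ω} ∩
        {ω | b * √(2 * L * R.pulls i t ω) ≤ σ * R.excess i a t ω} := by
      ext ω; simp [A]
    rw [h1]
    exact (measurableSet_le measurable_const hpm).inter
      (measurableSet_le ((hpm.const_mul _).sqrt.const_mul _) (hem.const_mul _))
  -- Markov and union bound in one: on `A` the term of the slice containing the actual count is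
  -- already at least one.
  have hpt : ∀ ω, A.indicator 1 ω ≤ ∑ k ∈ Finset.range m, X k ω * Real.exp (-((1 + δ) * L)) := by
    intro ω
    have hnn : ∀ k ∈ Finset.range m, 0 ≤ X k ω * Real.exp (-((1 + δ) * L)) := fun k _ => by
      positivity
    by_cases hω : ω ∈ A
    · obtain ⟨k, hk, hk1, hk2⟩ := exists_pow_slice hδ hω.1 (R.pulls_le i t ω)
      rw [Set.indicator_of_mem hω, Pi.one_apply]
      refine le_trans ?_ (Finset.single_le_sum hnn (Finset.mem_range.2 hk))
      have h1 := peeling_exponent hδ hδ' hN' hb'0 hb'sq hL (Nat.cast_nonneg _) (by positivity) hk1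
        hk2 ((mul_le_mul_of_nonneg_right hb'b (Real.sqrt_nonneg _)).trans hω.2)
      rw [← Real.exp_add]
      refine Real.one_le_exp ?_
      have h2 : (σ * l k) ^ 2 = l k ^ 2 := by rw [mul_pow, hσ, one_mul]
      rw [h2]
      have h3 : σ * l k * R.excess i a t ω = l k * (σ * R.excess i a t ω) := by ring
      rw [h3]
      linarith
    · rw [Set.indicator_of_notMem hω]; exact Finset.sum_nonneg hnn
  have hint : R.μ.real A ≤ ∑ k ∈ Finset.range m, (∫ ω, X k ω ∂(R.μ)) *
      Real.exp (-((1 + δ) * L)) := by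
    calc R.μ.real A = ∫ ω, A.indicator 1 ω ∂(R.μ) := (integral_indicator_one hA).symm
      _ ≤ ∫ ω, ∑ k ∈ Finset.range m, X k ω * Real.exp (-((1 + δ) * L)) ∂(R.μ) :=
          integral_mono ((integrable_const _).indicator hA)
            (integrable_finsetSum _ fun k _ => (hXint k).mul_const _) hpt
      _ = _ := by
          rw [integral_finsetSum _ fun k _ => (hXint k).mul_const _]
          exact Finset.sum_congr rfl fun k _ => integral_mul_const _ _
  refine hint.trans ((Finset.sum_le_card_nsmul _ _ (Real.exp (-((1 + δ) * L))) fun k _ =>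
    mul_le_of_le_one_left (Real.exp_pos _).le
      (H.integral_exp_excess_le_one hN hν ha ha01 _ t)).trans ?_)
  rw [Finset.card_range, nsmul_eq_mul]
  exact slice_count_mul_exp_le hδ hδ' hL

end Run.IsStationarySD

/-! ### Counting the selections of a suboptimal drafter. -/

namespace Run

variable {K N : ℕ} {V : Type v} [Fintype V] [MeasurableSpace V] {R : Run.{u, v} K N V}

/-- A drafter is selected at most `⌈x⌉` times while its number of selections is below `x`. -/
theorem card_arm_pulls_lt (i : Fin K) (x : ℝ) (s : Finset ℕ) (ω : R.Ω) :
    (s.filter fun t => R.arm t ω = i ∧ (R.pulls i t ω : ℝ) < x).card ≤ ⌈x⌉₊ := by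
  rw [← Finset.card_range ⌈x⌉₊]
  -- Each selection raises the count, so the counts seen at selection times are distinct integers
  -- below `⌈x⌉₊`.
  refine Finset.card_le_card_of_injOn (fun t => R.pulls i t ω) (fun t ht => ?_) ?_
  · have := (Finset.mem_filter.1 ht).2.2
    simpa using Nat.lt_ceil.2 this
  · have hmono : ∀ t t', R.arm t ω = i → t < t' → R.pulls i t ω < R.pulls i t' ω := by
      intro t t' ht htt'
      have h1 : R.pulls i (t + 1) ω = R.pulls i t ω + 1 := by rw [pulls_succ, if_pos ht]
      have h2 : R.pulls i (t + 1) ω ≤ R.pulls i t' ω :=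
        monotone_nat_of_le_succ (f := fun n => R.pulls i n ω)
          (fun n => by rw [pulls_succ]; exact Nat.le_add_right _ _) htt'
      omega
    intro t ht t' ht' heq
    have h1 := (Finset.mem_filter.1 ht).2.1
    have h2 := (Finset.mem_filter.1 ht').2.1
    rcases lt_trichotomy t t' with h | h | h
    · exact absurd heq (hmono t t' h1 h).ne
    · exact h
    · exact absurd heq (hmono t' t h2 h).ne'

theorem pulls_pos {t : ℕ} {i : Fin K} {ω : R.Ω} (h0 : R.arm i ω = i) (ht : K ≤ t) :
    1 ≤ R.pulls i t ω :=
  Finset.card_pos.2 ⟨i, Finset.mem_filter.2 ⟨Finset.mem_range.2 (i.2.trans_le ht), h0⟩⟩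

variable (R) in
/-- The event that the rewards of drafter `i` deviate from `a` by the confidence width, upwards
for `σ = 1` and downwards for `σ = -1`. -/
def deviates (i : Fin K) (a b σ : ℝ) (t : ℕ) : Set R.Ω :=
  {ω | 1 ≤ R.pulls i t ω ∧ b * √(2 * Real.log t * R.pulls i t ω) ≤ σ * R.excess i a t ω}

/-- If the index of drafter `i` is at least that of a drafter with a larger mean, and both
empirical means are within the confidence widths, then drafter `i` was selected rarely. -/
theorem pulls_lt_of_ucbIndex_le {i k : Fin K} {a a' b : ℝ} (haa' : a < a') {t : ℕ}
    {ω : R.Ω} (hi : 1 ≤ R.pulls i t ω) (hk : 1 ≤ R.pulls k t ω)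
    (hle : R.ucbIndex b k t ω ≤ R.ucbIndex b i t ω) (hdi : ω ∉ R.deviates i a b 1 t)
    (hdk : ω ∉ R.deviates k a' b (-1) t) :
    (R.pulls i t ω : ℝ) < 8 * b ^ 2 * Real.log t / (a' - a) ^ 2 := by
  have hL : 0 ≤ Real.log (t : ℝ) := Real.log_natCast_nonneg t
  have hsqrt : ∀ n : ℝ, 0 < n → √(2 * Real.log t * n) = n * √(2 * Real.log t / n) := by
    intro n hn
    rw [show 2 * Real.log t * n = n ^ 2 * (2 * Real.log t / n) by field_simp,
      Real.sqrt_mul (by positivity), Real.sqrt_sq hn.le]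
  have hi' : (0 : ℝ) < R.pulls i t ω := by exact_mod_cast hi
  have hk' : (0 : ℝ) < R.pulls k t ω := by exact_mod_cast hk
  have h1 : 1 * R.excess i a t ω < b * √(2 * Real.log t * R.pulls i t ω) :=
    not_le.1 fun h => hdi ⟨hi, h⟩
  have h2 : -1 * R.excess k a' t ω < b * √(2 * Real.log t * R.pulls k t ω) :=
    not_le.1 fun h => hdk ⟨hk, h⟩
  rw [hsqrt _ hi', excess_eq_pulls_mul] at h1
  rw [hsqrt _ hk', excess_eq_pulls_mul] at h2
  unfold ucbIndex at hle
  have h3 : R.empMean i t ω - a < b * √(2 * Real.log t / R.pulls i t ω) :=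
    lt_of_mul_lt_mul_left (by linarith) hi'.le
  have h4 : a' - R.empMean k t ω < b * √(2 * Real.log t / R.pulls k t ω) :=
    lt_of_mul_lt_mul_left (by linarith) hk'.le
  -- The better drafter's index exceeds `a'`, that of `i` is below `a` plus two widths, and the
  -- first does not exceed the second.
  have h5 : a' - a < 2 * b * √(2 * Real.log t / R.pulls i t ω) := by linarith
  have h6 : (a' - a) ^ 2 < (2 * b * √(2 * Real.log t / R.pulls i t ω)) ^ 2 :=
    pow_lt_pow_left₀ h5 (by linarith) two_ne_zero
  rw [mul_pow, Real.sq_sqrt (by positivity), mul_div_assoc', lt_div_iff₀ hi'] at h6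
  rw [lt_div_iff₀ (by nlinarith)]
  linarith

namespace IsStationarySD

variable {ν : Fin K → Measure ℝ} {α : Fin K → ℝ}

theorem measurableSet_deviates (H : R.IsStationarySD ν) (i : Fin K) (a b σ : ℝ) (t : ℕ) :
    MeasurableSet (R.deviates i a b σ t) := by
  have hpm : Measurable fun ω => (R.pulls i t ω : ℝ) :=
    (H.measurable_pulls i t).mono (R.ℱ.le t) le_rfl
  have hem : Measurable (R.excess i a t) := (H.measurable_excess i a t).mono (R.ℱ.le t) le_rfl
  have h1 : R.deviates i a b σ t = {ω | (1 : ℝ) ≤ R.pulls i t ω} ∩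
      {ω | b * √(2 * Real.log t * R.pulls i t ω) ≤ σ * R.excess i a t ω} := by
    ext ω; simp [deviates]
  rw [h1]
  exact (measurableSet_le measurable_const hpm).inter
    (measurableSet_le ((hpm.const_mul _).sqrt.const_mul _) (hem.const_mul _))

/-- The expected number of selections of a suboptimal drafter by the upper confidence rule. -/
theorem sum_measureReal_arm_le (H : R.IsStationarySD ν) (hN : 1 ≤ N)
    [∀ i, IsProbabilityMeasure (ν i)] (hν : ∀ i, ∀ᵐ x ∂(ν i), x ∈ Set.Icc (0 : ℝ) 1)
    (hα : ∀ i, α i = ∫ x, x ∂(ν i)) (hα01 : ∀ i, α i ∈ Set.Icc (0 : ℝ) 1) {b δ : ℝ}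
    (hb : 0 ≤ b) (hδ : 0 < δ) (hδ' : δ ≤ 3 / 2) (hbδ : 1 + 2 * δ ≤ 4 * N * b ^ 2)
    (hU : R.IsMetaSDUCB b) {i istar : Fin K} (hlt : α i < α istar) (B : ℕ) :
    ∑ t ∈ Finset.Ico K B, R.μ.real {ω | R.arm t ω = i} ≤
      8 * b ^ 2 * Real.log B / (α istar - α i) ^ 2 + 1 + 28 / δ ^ 3 := by
  classical
  have := H.isProbabilityMeasure
  have hK : 2 ≤ K := by
    have h1 : i.val ≠ istar.val := fun h => hlt.ne (by rw [Fin.ext h])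
    have := i.2; have := istar.2; omega
  -- One threshold for all `t < B`, with `log t` raised to `log B`.
  set x := 8 * b ^ 2 * Real.log B / (α istar - α i) ^ 2
  have hx : 0 ≤ x := by
    have := Real.log_natCast_nonneg B
    positivity
  have hdev : ∀ k σ, σ ^ 2 = 1 → ∑ t ∈ Finset.Ico K B, R.μ.real (R.deviates k (α k) b σ t) ≤
      14 / δ ^ 3 := by
    intro k σ hσ
    calc _ ≤ ∑ t ∈ Finset.Ico K B, 7 / δ ^ 2 * Real.exp (-(1 + δ / 2) * Real.log t) :=
          Finset.sum_le_sum fun t ht => H.measureReal_deviation_le hN (hν k) (hα k) (hα01 k) hδ hδ'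
            hb hbδ hσ (by have := (Finset.mem_Ico.1 ht).1; omega)
      _ ≤ 7 / δ ^ 2 * (1 / (δ / 2)) := by
          rw [← Finset.mul_sum]
          exact mul_le_mul_of_nonneg_left (sum_Ico_exp_neg_mul_log_le (by positivity) hK B)
            (by positivity)
      _ = _ := by field_simp; norm_num
  have hpt : ∀ ω, ∑ t ∈ Finset.Ico K B, {ω | R.arm t ω = i}.indicator (1 : R.Ω → ℝ) ω ≤ x + 1 +
      ∑ t ∈ Finset.Ico K B, ((R.deviates i (α i) b 1 t).indicator (1 : R.Ω → ℝ) ω +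
        (R.deviates istar (α istar) b (-1) t).indicator (1 : R.Ω → ℝ) ω) := by
    intro ω
    have h1 : ∀ t ∈ Finset.Ico K B, {ω | R.arm t ω = i}.indicator (1 : R.Ω → ℝ) ω ≤
        (if R.arm t ω = i ∧ (R.pulls i t ω : ℝ) < x then 1 else 0) +
        ((R.deviates i (α i) b 1 t).indicator (1 : R.Ω → ℝ) ω +
          (R.deviates istar (α istar) b (-1) t).indicator (1 : R.Ω → ℝ) ω) := by
      intro t ht
      obtain ⟨ht1, ht2⟩ := Finset.mem_Ico.1 ht
      have hnn : ∀ S : Set R.Ω, 0 ≤ S.indicator (1 : R.Ω → ℝ) ω := fun S =>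
        Set.indicator_nonneg (fun _ _ => zero_le_one) ω
      by_cases ha : R.arm t ω = i
      · by_cases hd : ω ∈ R.deviates i (α i) b 1 t
        · have := hnn (R.deviates istar (α istar) b (-1) t)
          simp only [Set.indicator_of_mem hd, Pi.one_apply]
          rw [Set.indicator_of_mem (show ω ∈ {ω | R.arm t ω = i} from ha)]
          split_ifs <;> simp <;> linarith
        · by_cases hd' : ω ∈ R.deviates istar (α istar) b (-1) t
          · simp only [Set.indicator_of_mem hd', Pi.one_apply]
            rw [Set.indicator_of_mem (show ω ∈ {ω | R.arm t ω = i} from ha),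
              Set.indicator_of_notMem hd]
            split_ifs <;> simp
          · have h2 := pulls_lt_of_ucbIndex_le hlt (pulls_pos (hU.1 i ω) ht1)
              (pulls_pos (hU.1 istar ω) ht1) (ha ▸ hU.2 t ht1 ω istar) hd hd'
            have h3 : (R.pulls i t ω : ℝ) < x := by
              refine h2.trans_le ?_
              have hlog : Real.log t ≤ Real.log B :=
                Real.log_le_log (by exact_mod_cast (by omega : 0 < t)) (by exact_mod_cast ht2.le)
              simp only [x]
              gcongr
            rw [if_pos ⟨ha, h3⟩, Set.indicator_of_mem (show ω ∈ {ω | R.arm t ω = i} from ha),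
              Set.indicator_of_notMem hd, Set.indicator_of_notMem hd']
            simp
      · rw [Set.indicator_of_notMem (show ω ∉ {ω | R.arm t ω = i} from ha),
          if_neg fun h => ha h.1]
        have h1 := hnn (R.deviates i (α i) b 1 t)
        have h2 := hnn (R.deviates istar (α istar) b (-1) t)
        linarith
    refine (Finset.sum_le_sum h1).trans ?_
    rw [Finset.sum_add_distrib]
    gcongr
    rw [Finset.sum_boole]
    refine (Nat.cast_le.2 (card_arm_pulls_lt i x _ ω)).trans ?_
    exact (Nat.ceil_lt_add_one hx).le
  have hI : ∀ S : Set R.Ω, MeasurableSet S → Integrable (S.indicator (1 : R.Ω → ℝ)) R.μ :=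
    fun S hS => (integrable_const (1 : ℝ)).indicator hS
  have hd1 := fun t => hI _ (H.measurableSet_deviates i (α i) b 1 t)
  have hd2 := fun t => hI _ (H.measurableSet_deviates istar (α istar) b (-1) t)
  have hd12 : ∀ t, Integrable (fun ω => (R.deviates i (α i) b 1 t).indicator (1 : R.Ω → ℝ) ω +
      (R.deviates istar (α istar) b (-1) t).indicator (1 : R.Ω → ℝ) ω) R.μ := fun t =>
    (hd1 t).add (hd2 t)
  have hint := integral_mono (μ := R.μ)
    (integrable_finsetSum _ fun t _ => hI _ (H.measurableSet_arm_top t i))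
    ((integrable_const (x + 1)).add
      (integrable_finsetSum _ fun t _ => hd12 t)) hpt
  simp only [Pi.add_apply] at hint
  rw [integral_add (integrable_const _) (integrable_finsetSum _ fun t _ => hd12 t),
    integral_finsetSum _ (fun t _ => hI _ (H.measurableSet_arm_top t i)),
    integral_finsetSum _ (fun t _ => hd12 t)] at hint
  simp only [fun t => integral_add (hd1 t) (hd2 t), fun t => integral_indicator_one (μ := R.μ)
    (H.measurableSet_arm_top t i), fun t => integral_indicator_one (μ := R.μ)
    (H.measurableSet_deviates i (α i) b 1 t), fun t => integral_indicator_one (μ := R.μ)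
    (H.measurableSet_deviates istar (α istar) b (-1) t), integral_const, probReal_univ, one_smul,
    Finset.sum_add_distrib] at hint
  have h1 := hdev i 1 (by norm_num)
  have h2 := hdev istar (-1) (by norm_num)
  have h3 : 28 / δ ^ 3 = 14 / δ ^ 3 + 14 / δ ^ 3 := by ring
  linarith

end IsStationarySD

end Run

/-! ### The value function of the best drafter. -/

/-- The expected number of rounds until `b` more tokens are generated, if all rounds use a drafter
with mean acceptance rate `a`. -/
noncomputable def remainingRounds (N : ℕ) (a : ℝ) : ℕ → ℝ
  | 0 => 0
  | b + 1 => 1 + remainingRounds N a b + ∑ j : Fin N,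
      (remainingRounds N a (b - (j + 1)) - remainingRounds N a (b - j)) * a ^ ((j : ℕ) + 1)
termination_by b => b

/-- Abel summation from the tail probabilities `a ^ (j + 1)` of the accepted count to its point
probabilities. These are nonnegative for `a` in the unit interval, which monotonicity of the value
function requires. -/
theorem add_sum_sub_mul_pow (f : ℕ → ℝ) (a : ℝ) (N : ℕ) :
    f 0 + ∑ j : Fin N, (f (j + 1) - f j) * a ^ ((j : ℕ) + 1) =
      ∑ j : Fin N, (a ^ (j : ℕ) - a ^ ((j : ℕ) + 1)) * f j + a ^ N * f N := by
  induction N with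
  | zero => simp
  | succ N ih =>
    rw [Fin.sum_univ_castSucc, Fin.sum_univ_castSucc]
    simp only [Fin.val_castSucc, Fin.val_last]
    linear_combination ih

theorem remainingRounds_succ (N : ℕ) (a : ℝ) (b : ℕ) :
    remainingRounds N a (b + 1) = 1 + (∑ j : Fin N, (a ^ (j : ℕ) - a ^ ((j : ℕ) + 1)) *
      remainingRounds N a (b - j) + a ^ N * remainingRounds N a (b - N)) := by
  rw [← add_sum_sub_mul_pow fun j => remainingRounds N a (b - j), remainingRounds, add_assoc]
  rfl

theorem remainingRounds_monotone (N : ℕ) {a : ℝ} (ha : a ∈ Set.Icc (0 : ℝ) 1) :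
    Monotone (remainingRounds N a) := by
  have h0 : remainingRounds N a 0 = 0 := by rw [remainingRounds]
  refine monotone_nat_of_le_succ fun b => ?_
  induction b using Nat.strong_induction_on with
  | _ b ih =>
    rcases b with _ | b
    · rw [remainingRounds_succ]; simp [h0]
    -- Truncated subtraction clips an overshoot to zero missing tokens; beyond the clip the two
    -- arguments coincide.
    · have key : ∀ j, remainingRounds N a (b - j) ≤ remainingRounds N a (b + 1 - j) := by
        intro j
        rcases le_or_gt j b with h | h
        · rw [Nat.sub_add_comm h]; exact ih _ (by omega)
        · rw [show b - j = b + 1 - j by omega]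
      rw [remainingRounds_succ, remainingRounds_succ N a (b + 1)]
      gcongr with j
      · rw [pow_succ]
        exact sub_nonneg.2 (mul_le_of_le_one_right (pow_nonneg ha.1 _) ha.2)
      · exact key _
      · exact pow_nonneg ha.1 _
      · exact key _

/-! ### Token counts and their one-round conditional expectation. -/

namespace Run

variable {K N : ℕ} {V : Type v} [Fintype V] [MeasurableSpace V] {R : Run.{u, v} K N V}

theorem generated_succ (n : ℕ) (ω : R.Ω) :
    R.generated (n + 1) ω = R.generated n ω + (R.nAcc n ω + 1) :=
  Finset.sum_range_succ _ _

theorem generated_monotone (ω : R.Ω) : Monotone fun n => R.generated n ω :=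
  monotone_nat_of_le_succ fun n => by rw [generated_succ]; exact Nat.le_add_right _ _

theorem le_generated (n : ℕ) (ω : R.Ω) : n ≤ R.generated n ω := by
  induction n with
  | zero => exact Nat.zero_le _
  | succ n ih => rw [generated_succ]; omega

/-- Every round produces at least the target model's token, so the set in `rounds` contains `max m
B` and its infimum is attained. Writing `τ` as a count of needed rounds makes its expectation a sum
of probabilities. -/
theorem rounds_eq_card (m B : ℕ) (ω : R.Ω) :
    R.rounds m B ω =
      ((Finset.range (max m B)).filter fun s => s < m ∨ R.generated s ω < B).card := by
  have hne : max m B ∈ {n | m ≤ n ∧ B ≤ R.generated n ω} :=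
    ⟨le_max_left _ _, (le_max_right m B).trans (R.le_generated _ ω)⟩
  have hmem := Nat.sInf_mem ⟨_, hne⟩
  have hle : R.rounds m B ω ≤ max m B := Nat.sInf_le hne
  rw [← Finset.card_range (R.rounds m B ω)]
  congr 1
  ext s
  simp only [Finset.mem_range, Finset.mem_filter]
  constructor
  · intro hs
    refine ⟨hs.trans_le hle, ?_⟩
    by_contra! h
    exact Nat.notMem_of_lt_sInf hs h
  · rintro ⟨_, h⟩
    by_contra! hs
    rcases h with h | h
    · exact absurd (hmem.1.trans hs) (not_le.2 h)
    · exact absurd (hmem.2.trans (R.generated_monotone ω hs)) (not_le.2 h)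

theorem mem_passesFirst_iff_lt_nAcc (t : ℕ) (j : Fin N) (ω : R.Ω) :
    ω ∈ R.passesFirst t (j + 1) ↔ (j : ℕ) < R.nAcc t ω := by
  classical
  set S := Finset.univ.filter fun j : Fin N => ∀ k ≤ j, ω ∈ R.passes t k with hS
  have hn : R.nAcc t ω = S.card := by unfold nAcc; congr!
  have hiff : ω ∈ R.passesFirst t (j + 1) ↔ j ∈ S := by
    simp only [passesFirst, hS, Finset.mem_filter, Finset.mem_univ, true_and, Fin.le_def]
    exact forall_congr' fun k => by rw [Nat.lt_succ_iff]
  rw [hiff, hn]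
  constructor
  · intro h
    have hsub : Finset.Iic j ⊆ S := fun k hk => by
      rw [hS, Finset.mem_filter] at h ⊢
      exact ⟨Finset.mem_univ _, fun l hl => h.2 l (hl.trans (Finset.mem_Iic.1 hk))⟩
    have := Finset.card_le_card hsub
    rw [Fin.card_Iic] at this
    omega
  · intro h
    by_contra hj
    have hsub : S ⊆ Finset.Iio j := fun k hk => by
      rw [Finset.mem_Iio]
      by_contra! hjk
      refine hj ?_
      rw [hS, Finset.mem_filter] at hk ⊢
      exact ⟨Finset.mem_univ _, fun l hl => hk.2 l (hl.trans hjk)⟩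
    have := Finset.card_le_card hsub
    rw [Fin.card_Iio] at this
    omega

theorem nAcc_le (t : ℕ) (ω : R.Ω) : R.nAcc t ω ≤ N := by
  classical
  unfold nAcc
  exact (Finset.card_filter_le _ _).trans (by simp)

/-- Telescoping up to `nAcc` involves only the events that an initial block passes, whose
conditional probabilities are powers of `α`. -/
theorem comp_nAcc_eq (f : ℕ → ℝ) (t : ℕ) (ω : R.Ω) :
    f (R.nAcc t ω) = f 0 + ∑ j : Fin N,
      (f (j + 1) - f j) * (R.passesFirst t (j + 1)).indicator 1 ω := by
  classical
  have h1 : ∀ j : Fin N, (f (j + 1) - f j) * (R.passesFirst t (j + 1)).indicator 1 ω =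
      if (j : ℕ) < R.nAcc t ω then f (j + 1) - f j else 0 := by
    intro j
    simp only [Set.indicator_apply, mem_passesFirst_iff_lt_nAcc, Pi.one_apply, mul_ite, mul_one,
      mul_zero]
  have h2 : (Finset.range N).filter (fun j => j < R.nAcc t ω) = Finset.range (R.nAcc t ω) := by
    ext j
    have := R.nAcc_le t ω
    simp only [Finset.mem_filter, Finset.mem_range]
    omega
  simp only [h1]
  rw [Fin.sum_univ_eq_sum_range (fun j => if j < R.nAcc t ω then f (j + 1) - f j else 0) N,
    ← Finset.sum_filter, h2, Finset.sum_range_sub]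
  ring

namespace IsStationarySD

variable {ν : Fin K → Measure ℝ} {α : Fin K → ℝ}

theorem measurable_nAcc (H : R.IsStationarySD ν) (t : ℕ) : Measurable[R.ℱ (t + 1)] (R.nAcc t) := by
  classical
  have : R.nAcc t = fun ω => ∑ j : Fin N, if ω ∈ R.passesFirst t (j + 1) then 1 else 0 := by
    ext ω
    rw [Finset.sum_boole, nAcc]
    simp only [Nat.cast_id]
    congr! 2
    simp only [passesFirst, Fin.le_def]
    exact forall_congr' fun k => by rw [Nat.lt_succ_iff]
  rw [this]
  exact Finset.measurable_sum _ fun j _ =>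
    Measurable.ite (H.measurableSet_passesFirst t _) measurable_const measurable_const

theorem measurable_generated (H : R.IsStationarySD ν) (n : ℕ) :
    Measurable[R.ℱ n] (R.generated n) :=
  Finset.measurable_sum _ fun s hs =>
    ((H.measurable_nAcc s).mono (R.ℱ.mono (Finset.mem_range.1 hs)) le_rfl).add measurable_const

theorem measurableSet_generated_lt (H : R.IsStationarySD ν) (n B : ℕ) :
    MeasurableSet {ω | R.generated n ω < B} :=
  R.ℱ.le n _ (H.measurable_generated n (measurableSet_Iio (a := B)))

/-- The expected value of a bounded function of the tokens generated in `n + 1` rounds. -/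
theorem integral_comp_generated_succ [MeasurableSingletonClass V] (H : R.IsStationarySD ν)
    (hα : ∀ i, α i = ∫ x, x ∂(ν i)) (hα01 : ∀ i, α i ∈ Set.Icc (0 : ℝ) 1) {f : ℕ → ℝ} {C : ℝ}
    (hf : ∀ k, |f k| ≤ C) (n : ℕ) :
    Integrable (fun ω => f (R.generated n ω + 1) + ∑ j : Fin N,
      (f (R.generated n ω + 1 + (j + 1)) - f (R.generated n ω + 1 + j)) *
        α (R.arm n ω) ^ ((j : ℕ) + 1)) R.μ ∧
    ∫ ω, f (R.generated (n + 1) ω) ∂(R.μ) =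
      ∫ ω, f (R.generated n ω + 1) + ∑ j : Fin N,
        (f (R.generated n ω + 1 + (j + 1)) - f (R.generated n ω + 1 + j)) *
          α (R.arm n ω) ^ ((j : ℕ) + 1) ∂(R.μ) := by
  have := H.isProbabilityMeasure
  have hg := H.measurable_generated n
  have hfm : Measurable f := measurable_of_countable f
  have hfg : ∀ k, Measurable[R.ℱ n] fun ω => f (R.generated n ω + 1 + k) := fun k =>
    hfm.comp ((hg.add measurable_const).add measurable_const)
  have hi : ∀ {φ : R.Ω → ℝ}, Measurable[R.ℱ n] φ → ∀ {D : ℝ}, (∀ ω, |φ ω| ≤ D) →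
      Integrable φ R.μ := fun hφ _ hD => H.integrable_of_bound (hφ.mono (R.ℱ.le n) le_rfl) hD
  have hdm : ∀ j : Fin N, Measurable[R.ℱ n] fun ω =>
      f (R.generated n ω + 1 + (j + 1)) - f (R.generated n ω + 1 + j) := fun j =>
    (hfg (j + 1)).sub (hfg j)
  have hdb : ∀ (j : Fin N) (ω : R.Ω),
      |f (R.generated n ω + 1 + (j + 1)) - f (R.generated n ω + 1 + j)| ≤ C + C := fun j ω =>
    (abs_sub _ _).trans (add_le_add (hf _) (hf _))
  have hI0 : Integrable (fun ω => f (R.generated n ω + 1)) R.μ := hi (hfg 0) fun ω => hf _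
  have hIα : ∀ j : Fin N, Integrable (fun ω =>
      (f (R.generated n ω + 1 + (j + 1)) - f (R.generated n ω + 1 + j)) *
        α (R.arm n ω) ^ ((j : ℕ) + 1)) R.μ := fun j =>
    hi (D := (C + C) * 1) ((hdm j).mul (H.measurable_comp_arm n fun i => α i ^ ((j : ℕ) + 1)))
      fun ω => by
        rw [abs_mul]
        refine mul_le_mul (hdb j ω) ?_ (abs_nonneg _) ((abs_nonneg _).trans (hdb j ω))
        rw [abs_of_nonneg (pow_nonneg (hα01 _).1 _)]
        exact pow_le_one₀ (hα01 _).1 (hα01 _).2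
  have hIp : ∀ j : Fin N, Integrable (fun ω =>
      (f (R.generated n ω + 1 + (j + 1)) - f (R.generated n ω + 1 + j)) *
        (R.passesFirst n (j + 1)).indicator 1 ω) R.μ := fun j =>
    H.integrable_of_bound (C := (C + C) * 1) (((hdm j).mono (R.ℱ.le n) le_rfl).mul
      (measurable_const.indicator (R.ℱ.le _ _ (H.measurableSet_passesFirst n _)))) fun ω => by
        rw [abs_mul]
        refine mul_le_mul (hdb j ω) ?_ (abs_nonneg _) ((abs_nonneg _).trans (hdb j ω))
        by_cases h : ω ∈ R.passesFirst n (j + 1) <;> simp [h]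
  refine ⟨hI0.add (integrable_finsetSum _ fun j _ => hIα j), ?_⟩
  have hpt : ∀ ω, f (R.generated (n + 1) ω) = f (R.generated n ω + 1) + ∑ j : Fin N,
      (f (R.generated n ω + 1 + (j + 1)) - f (R.generated n ω + 1 + j)) *
        (R.passesFirst n (j + 1)).indicator 1 ω := by
    intro ω
    rw [generated_succ, ← R.comp_nAcc_eq (fun k => f (R.generated n ω + 1 + k))]
    congr 1; ring
  simp only [hpt]
  rw [integral_add hI0 (integrable_finsetSum _ fun j _ => hIp j),
    integral_add hI0 (integrable_finsetSum _ fun j _ => hIα j),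
    integral_finsetSum _ fun j _ => hIp j, integral_finsetSum _ fun j _ => hIα j]
  congr 1
  exact Finset.sum_congr rfl fun j _ =>
    H.integral_mul_passesFirst hα hα01 n j.2 (hdm j) (hdb j)

end IsStationarySD

end Run

/-! ### Comparing the number of rounds with the value function. -/

theorem remainingRounds_nonneg (N : ℕ) {a : ℝ} (ha : a ∈ Set.Icc (0 : ℝ) 1) (b : ℕ) :
    0 ≤ remainingRounds N a b := by
  have h := remainingRounds_monotone N ha (Nat.zero_le b)
  rwa [remainingRounds] at h

/-- Bellman's equation with `g` tokens already generated: the round costs one if it is needed, and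
once `g ≥ B` all terms are clipped to `V 0 = 0`. -/
theorem remainingRounds_sub_eq (N : ℕ) (a : ℝ) (B g : ℕ) :
    remainingRounds N a (B - (g + 1)) + ∑ j : Fin N,
      (remainingRounds N a (B - (g + 1 + (j + 1))) - remainingRounds N a (B - (g + 1 + j))) *
        a ^ ((j : ℕ) + 1) =
      remainingRounds N a (B - g) - if g < B then 1 else 0 := by
  split_ifs with h
  · obtain ⟨b, rfl⟩ : ∃ b, B = g + 1 + b := ⟨B - (g + 1), by omega⟩
    rw [show g + 1 + b - g = b + 1 by omega, remainingRounds]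
    simp only [Nat.add_sub_add_left, Nat.add_sub_cancel_left]
    ring
  · have h0 : ∀ k, B - (g + k) = 0 := fun k => by omega
    simp only [add_assoc, h0, sub_self, zero_mul, Finset.sum_const_zero]
    rw [show B - g = 0 by omega]
    simp

/-- Rounds with a smaller acceptance rate leave more rounds to come. -/
theorem remainingRounds_sub_mono (N : ℕ) {a x y : ℝ} (ha : a ∈ Set.Icc (0 : ℝ) 1) (hx : 0 ≤ x)
    (hxy : x ≤ y) (B g : ℕ) :
    remainingRounds N a (B - (g + 1)) + ∑ j : Fin N,
      (remainingRounds N a (B - (g + 1 + (j + 1))) - remainingRounds N a (B - (g + 1 + j))) *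
        y ^ ((j : ℕ) + 1) ≤
    remainingRounds N a (B - (g + 1)) + ∑ j : Fin N,
      (remainingRounds N a (B - (g + 1 + (j + 1))) - remainingRounds N a (B - (g + 1 + j))) *
        x ^ ((j : ℕ) + 1) := by
  refine add_le_add le_rfl (Finset.sum_le_sum fun j _ => ?_)
  exact mul_le_mul_of_nonpos_left (pow_le_pow_left₀ hx hxy _)
    (sub_nonpos.2 (remainingRounds_monotone N ha
      (show B - (g + 1 + (j + 1)) ≤ B - (g + 1 + j) by omega)))

theorem remainingRounds_sub_le (N : ℕ) {a x : ℝ} (ha : a ∈ Set.Icc (0 : ℝ) 1) (hx : 0 ≤ x)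
    (B g : ℕ) :
    remainingRounds N a (B - (g + 1)) + ∑ j : Fin N,
      (remainingRounds N a (B - (g + 1 + (j + 1))) - remainingRounds N a (B - (g + 1 + j))) *
        x ^ ((j : ℕ) + 1) ≤ remainingRounds N a (B - g) := by
  -- The worst case is rate zero, when the round still yields one token.
  refine (remainingRounds_sub_mono N ha le_rfl hx B g).trans ?_
  simpa using remainingRounds_monotone N ha (show B - (g + 1) ≤ B - g by omega)

namespace Run.IsStationarySD

variable {K N : ℕ} {V : Type v} [Fintype V] [MeasurableSpace V] {R : Run.{u, v} K N V}
  {ν : Fin K → Measure ℝ} {α : Fin K → ℝ}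

theorem expectedRounds_eq_sum (H : R.IsStationarySD ν) (m B : ℕ) :
    R.expectedRounds m B =
      ∑ s ∈ Finset.range (max m B), R.μ.real {ω | s < m ∨ R.generated s ω < B} := by
  classical
  have := H.isProbabilityMeasure
  have hS : ∀ s, MeasurableSet {ω | s < m ∨ R.generated s ω < B} := fun s =>
    (MeasurableSet.const (s < m)).union (H.measurableSet_generated_lt s B)
  have h : ∀ ω, (R.rounds m B ω : ℝ) = ∑ s ∈ Finset.range (max m B),
      {ω | s < m ∨ R.generated s ω < B}.indicator (1 : R.Ω → ℝ) ω := by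
    intro ω
    rw [rounds_eq_card, ← Finset.sum_boole]
    simp only [Set.indicator_apply, Set.mem_ofPred_eq, Pi.one_apply]
  simp only [expectedRounds, h]
  have hI : ∀ s, Integrable ({ω | s < m ∨ R.generated s ω < B}.indicator (1 : R.Ω → ℝ)) R.μ :=
    fun s => (integrable_const (1 : ℝ)).indicator (hS s)
  rw [integral_finsetSum _ fun s _ => hI s]
  exact Finset.sum_congr rfl fun s _ => integral_indicator_one (hS s)

theorem integrable_remainingRounds (H : R.IsStationarySD ν) {a : ℝ} (ha : a ∈ Set.Icc (0 : ℝ) 1)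
    (n B : ℕ) : Integrable (fun ω => remainingRounds N a (B - R.generated n ω)) R.μ :=
  H.integrable_of_bound (C := remainingRounds N a B)
    ((measurable_of_countable fun k => remainingRounds N a (B - k)).comp
      ((H.measurable_generated n).mono (R.ℱ.le n) le_rfl)) fun ω => by
        rw [abs_of_nonneg (remainingRounds_nonneg N ha _)]
        exact remainingRounds_monotone N ha (Nat.sub_le _ _)

theorem abs_remainingRounds_sub_le {a : ℝ} (ha : a ∈ Set.Icc (0 : ℝ) 1) (B k : ℕ) :
    |remainingRounds N a (B - k)| ≤ remainingRounds N a B := by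
  rw [abs_of_nonneg (remainingRounds_nonneg N ha _)]
  exact remainingRounds_monotone N ha (Nat.sub_le _ _)

/-- No policy needs fewer rounds in expectation than the constant use of the best drafter. -/
theorem remainingRounds_le_expectedRounds [MeasurableSingletonClass V] (H : R.IsStationarySD ν)
    (hα : ∀ i, α i = ∫ x, x ∂(ν i)) (hα01 : ∀ i, α i ∈ Set.Icc (0 : ℝ) 1) {istar : Fin K}
    (hmax : ∀ i, α i ≤ α istar) (B : ℕ) :
    remainingRounds N (α istar) B ≤ R.expectedRounds 0 B := by
  have := H.isProbabilityMeasure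
  have ha := hα01 istar
  have key : ∀ n, remainingRounds N (α istar) B ≤
      ∫ ω, remainingRounds N (α istar) (B - R.generated n ω) ∂(R.μ) +
        ∑ s ∈ Finset.range n, R.μ.real {ω | R.generated s ω < B} := by
    intro n
    induction n with
    | zero => simp [generated]
    | succ n ih =>
      have hI : Integrable ({ω | R.generated n ω < B}.indicator (1 : R.Ω → ℝ)) R.μ :=
        (integrable_const (1 : ℝ)).indicator (H.measurableSet_generated_lt n B)
      obtain ⟨h1, h2⟩ := H.integral_comp_generated_succ hα hα01
        (f := fun k => remainingRounds N (α istar) (B - k))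
        (abs_remainingRounds_sub_le ha B) n
      have h3 := integral_mono ((H.integrable_remainingRounds ha n B).sub hI) h1 fun ω => by
        refine le_of_eq_of_le ?_ (remainingRounds_sub_mono N ha (hα01 (R.arm n ω)).1
          (hmax (R.arm n ω)) B (R.generated n ω))
        rw [remainingRounds_sub_eq]
        simp [Set.indicator_apply]
      rw [← h2, integral_sub' (H.integrable_remainingRounds ha n B) hI,
        integral_indicator_one (H.measurableSet_generated_lt n B)] at h3
      rw [Finset.sum_range_succ]
      linarith
  -- After `B` rounds at least `B` tokens exist, so the remaining value vanishes.
  have h := key B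
  have h0 : ∀ ω, B - R.generated B ω = 0 := fun ω => Nat.sub_eq_zero_of_le (R.le_generated B ω)
  have hz : remainingRounds N (α istar) 0 = 0 := by rw [remainingRounds]
  rw [H.expectedRounds_eq_sum]
  simpa [h0, hz] using h

/-- The expected number of rounds with the best drafter before `B` tokens are generated. -/
theorem sum_measureReal_best_arm_le [MeasurableSingletonClass V] (H : R.IsStationarySD ν)
    (hα : ∀ i, α i = ∫ x, x ∂(ν i)) (hα01 : ∀ i, α i ∈ Set.Icc (0 : ℝ) 1) (istar : Fin K)
    (B n : ℕ) :
    ∑ s ∈ Finset.range n, R.μ.real ({ω | R.generated s ω < B} ∩ {ω | R.arm s ω = istar}) ≤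
      remainingRounds N (α istar) B := by
  classical
  have := H.isProbabilityMeasure
  have ha := hα01 istar
  suffices key : ∫ ω, remainingRounds N (α istar) (B - R.generated n ω) ∂(R.μ) +
      ∑ s ∈ Finset.range n, R.μ.real ({ω | R.generated s ω < B} ∩ {ω | R.arm s ω = istar}) ≤
        remainingRounds N (α istar) B by
    have : 0 ≤ ∫ ω, remainingRounds N (α istar) (B - R.generated n ω) ∂(R.μ) :=
      integral_nonneg fun ω => remainingRounds_nonneg N ha _
    linarith
  induction n with
  | zero => simp [generated]
  | succ n ih =>
    have hS := (H.measurableSet_generated_lt n B).inter (H.measurableSet_arm_top n istar)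
    have hI : Integrable (({ω | R.generated n ω < B} ∩ {ω | R.arm n ω = istar}).indicator
        (1 : R.Ω → ℝ)) R.μ := (integrable_const (1 : ℝ)).indicator hS
    obtain ⟨h1, h2⟩ := H.integral_comp_generated_succ hα hα01
      (f := fun k => remainingRounds N (α istar) (B - k)) (abs_remainingRounds_sub_le ha B) n
    have h3 := integral_mono h1 ((H.integrable_remainingRounds ha n B).sub hI) fun ω => by
      by_cases h : R.arm n ω = istar
      · refine le_of_eq ?_
        simp only [h]
        rw [remainingRounds_sub_eq]
        simp [Set.indicator_apply, h]
      · refine (remainingRounds_sub_le N ha (hα01 (R.arm n ω)).1 B (R.generated n ω)).trans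
          (le_of_eq ?_)
        simp [h]
    rw [← h2, integral_sub' (H.integrable_remainingRounds ha n B) hI,
      integral_indicator_one hS] at h3
    rw [Finset.sum_range_succ]
    linarith

/-- The first `K` rounds cost at most `K`. Later needed rounds with the best drafter cost at most `V
B`; suboptimal ones are overcounted by all selections before round `B`, even after generation has
stopped. -/
theorem expectedRounds_le [MeasurableSingletonClass V] (H : R.IsStationarySD ν)
    (hα : ∀ i, α i = ∫ x, x ∂(ν i)) (hα01 : ∀ i, α i ∈ Set.Icc (0 : ℝ) 1) (istar : Fin K)
    (B : ℕ) :
    R.expectedRounds K B ≤ K + remainingRounds N (α istar) B +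
      ∑ i ∈ Finset.univ.erase istar, ∑ t ∈ Finset.Ico K B, R.μ.real {ω | R.arm t ω = i} := by
  have := H.isProbabilityMeasure
  have hIco : Finset.Ico K (max K B) = Finset.Ico K B := by
    ext s; simp only [Finset.mem_Ico]; omega
  rw [H.expectedRounds_eq_sum, ← Finset.sum_range_add_sum_Ico _ (le_max_left K B), hIco, add_assoc]
  gcongr
  · exact (Finset.sum_le_card_nsmul _ _ 1 fun _ _ => measureReal_le_one).trans (by simp)
  have h1 : ∀ t ∈ Finset.Ico K B, R.μ.real {ω | t < K ∨ R.generated t ω < B} ≤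
      R.μ.real ({ω | R.generated t ω < B} ∩ {ω | R.arm t ω = istar}) +
        ∑ i ∈ Finset.univ.erase istar, R.μ.real {ω | R.arm t ω = i} := by
    intro t ht
    have htK := (Finset.mem_Ico.1 ht).1
    refine (measureReal_mono (s₂ := ({ω | R.generated t ω < B} ∩ {ω | R.arm t ω = istar}) ∪
      ⋃ i ∈ Finset.univ.erase istar, {ω | R.arm t ω = i}) fun ω hω => ?_).trans
      ((measureReal_union_le _ _).trans (by gcongr; exact measureReal_biUnion_finset_le _ _))
    have hlt : R.generated t ω < B := hω.resolve_left (by omega)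
    by_cases h : R.arm t ω = istar
    · exact Or.inl ⟨hlt, h⟩
    · exact Or.inr (by simpa using h)
  refine (Finset.sum_le_sum h1).trans ?_
  rw [Finset.sum_add_distrib, Finset.sum_comm]
  gcongr
  refine le_trans ?_ (H.sum_measureReal_best_arm_le hα hα01 istar B B)
  refine Finset.sum_le_sum_of_subset_of_nonneg (fun s hs => ?_) fun _ _ _ => measureReal_nonneg
  exact Finset.mem_range.2 (Finset.mem_Ico.1 hs).2

/-- The support of `ν i` is not assumed but forced: in a round that surely uses drafter `i`, a rate
in the unit interval has law `ν i`. -/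
theorem ae_mem_Icc_of_arm_eq (H : R.IsStationarySD ν) (hN : 1 ≤ N)
    [∀ i, IsProbabilityMeasure (ν i)] {i : Fin K} {t : ℕ} (hi : ∀ ω, R.arm t ω = i) :
    ∀ᵐ x ∂(ν i), x ∈ Set.Icc (0 : ℝ) 1 := by
  have := H.isProbabilityMeasure
  have h := H.rate_law t ⟨0, hN⟩ i Set.univ MeasurableSet.univ (fun ω _ => hi ω)
    (Set.Icc (0 : ℝ) 1)ᶜ measurableSet_Icc.compl
  have hempty : R.rate t ⟨0, hN⟩ ⁻¹' (Set.Icc (0 : ℝ) 1)ᶜ = ∅ :=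
    Set.eq_empty_of_forall_notMem fun ω hω => hω (H.rate_mem_Icc t _ ω)
  rw [hempty, Set.inter_empty, measure_empty, measure_univ, one_mul] at h
  exact h.symm

end Run.IsStationarySD

theorem integral_mem_Icc {ρ : Measure ℝ} [IsProbabilityMeasure ρ]
    (hρ : ∀ᵐ x ∂ρ, x ∈ Set.Icc (0 : ℝ) 1) : ∫ x, x ∂ρ ∈ Set.Icc (0 : ℝ) 1 := by
  refine (convex_Icc (0 : ℝ) 1).integral_mem isClosed_Icc hρ ?_
  refine Integrable.of_bound aestronglyMeasurable_id 1 ?_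
  filter_upwards [hρ] with x hx
  rw [Real.norm_of_nonneg hx.1]
  exact hx.2

end MetaSD

/-! ### Assembly of the regret bound. -/

theorem mainTheorem9 :
    Tendsto MetaSD.betaConst (𝓝[>] (1 / 2)) atTop ∧
    ∃ c > (0 : ℝ), ∃ C' > (0 : ℝ), ∀ (K N : ℕ) (β : ℝ), 1 ≤ N → 1 / 2 < β →
      ∀ (V : Type v) [Fintype V] [MeasurableSpace V] [MeasurableSingletonClass V]
        (ν : Fin K → Measure ℝ) [∀ i, IsProbabilityMeasure (ν i)]
        (α : Fin K → ℝ) (istar : Fin K),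
        (∀ i, α i = ∫ x, x ∂(ν i)) →
        (∀ i, i ≠ istar → α i < α istar) →
        ∀ R : MetaSD.Run.{u, v} K N V, R.IsStationarySD ν → R.IsMetaSDUCB (β / √(N : ℝ)) →
        ∀ B : ℕ, 1 ≤ B →
          MetaSD.ucbRegret.{u, v} R ν B <
            ∑ i ∈ Finset.univ.erase istar, 8 * β ^ 2 / (N * (α istar - α i) ^ 2) *
                (Real.log B +
                  max 0 (Real.log (Real.log
                    (∑ k ∈ Finset.univ.erase istar, 1 / (α istar - α k) ^ 2))) + C') +
              c * K * MetaSD.betaConst β := by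
  -- Each suboptimal drafter costs at most `1 + 28 / δ ^ 3 ≤ 10 * betaConst β`; the initial `K`
  -- rounds fit strictly into the other `2 * K * betaConst β`, which makes the inequality strict.
  refine ⟨MetaSD.tendsto_betaConst, 12, by norm_num, 1, one_pos, ?_⟩
  intro K N β hN hβ V _ _ _ ν _ α istar hα hlt R H hU B hB
  have hN' : (0 : ℝ) < N := by exact_mod_cast hN
  have hK : (1 : ℝ) ≤ K := by exact_mod_cast istar.pos
  have hν : ∀ i, ∀ᵐ x ∂(ν i), x ∈ Set.Icc (0 : ℝ) 1 := fun i => H.ae_mem_Icc_of_arm_eq hN (hU.1 i)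
  have hα01 : ∀ i, α i ∈ Set.Icc (0 : ℝ) 1 := fun i => hα i ▸ MetaSD.integral_mem_Icc (hν i)
  have hmax : ∀ i, α i ≤ α istar := fun i => by
    rcases eq_or_ne i istar with rfl | h
    · exact le_rfl
    · exact (hlt i h).le
  have hopt : MetaSD.remainingRounds N (α istar) B ≤ MetaSD.optimalRounds.{u, v} N V ν B := by
    -- The given run itself shows that the infimum is not over an empty set.
    refine le_csInf ⟨_, R, H, rfl⟩ ?_
    rintro _ ⟨R', H', rfl⟩
    exact H'.remainingRounds_le_expectedRounds hα hα01 hmax B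
  obtain ⟨δ, hδ, hδ', hδβ, hδc⟩ := MetaSD.exists_peeling_parameter hβ
  have hD : 1 ≤ MetaSD.betaConst β := (MetaSD.betaConst_lower hβ rfl).2
  have hb : (β / √(N : ℝ)) ^ 2 = β ^ 2 / N := by rw [div_pow, Real.sq_sqrt hN'.le]
  have hlog : 0 ≤ Real.log B := Real.log_natCast_nonneg B
  have harm : ∀ i ∈ Finset.univ.erase istar,
      ∑ t ∈ Finset.Ico K B, R.μ.real {ω | R.arm t ω = i} ≤
        8 * β ^ 2 / (N * (α istar - α i) ^ 2) * (Real.log B +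
          max 0 (Real.log (Real.log
            (∑ k ∈ Finset.univ.erase istar, 1 / (α istar - α k) ^ 2))) + 1) +
          10 * MetaSD.betaConst β := by
    intro i hi
    have h1 := H.sum_measureReal_arm_le hN hν hα hα01 (b := β / √(N : ℝ)) (by positivity) hδ hδ'
      (by rw [hb]; field_simp; linarith) hU (hlt i (Finset.ne_of_mem_erase hi)) B
    have h2 : 8 * (β / √(N : ℝ)) ^ 2 * Real.log B / (α istar - α i) ^ 2 =
        8 * β ^ 2 / (N * (α istar - α i) ^ 2) * Real.log B := by
      rw [hb, mul_div_assoc', div_mul_eq_mul_div, div_div, div_mul_eq_mul_div]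
    have h3 : 8 * β ^ 2 / (N * (α istar - α i) ^ 2) * Real.log B ≤
        8 * β ^ 2 / (N * (α istar - α i) ^ 2) * (Real.log B +
          max 0 (Real.log (Real.log
            (∑ k ∈ Finset.univ.erase istar, 1 / (α istar - α k) ^ 2))) + 1) := by
      -- The iterated logarithm and `C'` are only required to be nonnegative here; `ln B` alone
      -- carries the bound.
      gcongr
      linarith [le_max_left 0 (Real.log (Real.log
            (∑ k ∈ Finset.univ.erase istar, 1 / (α istar - α k) ^ 2)))]
    linarith
  have hsum := Finset.sum_le_sum harm
  rw [Finset.sum_add_distrib, Finset.sum_const, nsmul_eq_mul] at hsum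
  have hcard : ((Finset.univ.erase istar).card : ℝ) ≤ K := by
    exact_mod_cast (Finset.card_erase_le).trans (by simp)
  have htot := H.expectedRounds_le hα hα01 istar B
  have h4 : ((Finset.univ.erase istar).card : ℝ) * (10 * MetaSD.betaConst β) ≤
      K * (10 * MetaSD.betaConst β) := by gcongr
  have h5 : (K : ℝ) < 2 * (K * MetaSD.betaConst β) := by nlinarith
  rw [MetaSD.ucbRegret]
  linarith
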